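/- **Notation.** Let $d\in\mathbb N$ and let $L(\mathbb T^d)$ be the space of functions on $\mathbb R^d$ that are $2\pi$-periodic in each variable and integrable over the period cube $\mathbb T^d$. Put $\widehat f(\mathbf k)=(2\pi)^{-d}\int_{\mathbb T^d}f(\mathbf x)e^{-i(\mathbf k,\mathbf x)}\,d\mathbf x$, $|\mathbf k|_1=\sum_j|k_j|$ and $H_\nu(f)(\mathbf x)=\sum_{|\mathbf k|_1=\nu}\widehat f(\mathbf k)e^{i(\mathbf k,\mathbf x)}$. For a trigonometric series $c=\sum_{\mathbf k\in\mathbb Z^d}c_{\mathbf k}e^{i(\mathbf k,\mathbf x)}$ let $\|c\|_{\mathcal S^p}=(\sum_{\mathbf k}|c_{\mathbf k}|^p)^{1/p}\in[0,\infty]$; the norm of a function is that of its Fourier series. For $r\in\mathbb N$ and $0\le\varrho<1$ the triangular Taylor–Abel–Poisson mean is $$A^\Delta_{\varrho,r}(f)=\sum_{\nu=0}^{r-1}H_\nu(f)+\sum_{\nu=r}^\infty\lambda_{\nu,r}(\varrho)H_\nu(f),\qquad \lambda_{\nu,r}(\varrho)=\sum_{k=0}^{r-1}\binom{\nu}{k}(1-\varrho)^k\varrho^{\nu-k}.$$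 For $m\in\mathbb N_0$ let $f^{[m]}$ be the trigonometric series with coefficients $\frac{\nu!}{(\nu-m)!}\widehat f(\mathbf k)$ for $|\mathbf k|_1=\nu\ge m$ and $0$ for $|\mathbf k|_1<m$; when it is the Fourier series of a function in $L(\mathbb T^d)$, it is identified with that function. The Poisson integral of a series $c$ is $P(c)(\varrho,\mathbf x)=\sum_{\nu\ge0}\varrho^\nu\sum_{|\mathbf k|_1=\nu}c_{\mathbf k}e^{i(\mathbf k,\mathbf x)}$; that of a function $g\in L(\mathbb T^d)$ is $(2\pi)^{-d}\int_{\mathbb T^d}g(\mathbf x+\mathbf t)\prod_{j=1}^d\frac{1-\varrho^2}{1-2\varrho\cos t_j+\varrho^2}\,d\mathbf t$. We write $c\in\mathcal S^pH^1_\omega$ if $\|c\|_{\mathcal S^p}<\infty$ and $\sup_{|h|\le\delta}\|c-c(\cdot-h)\|_{\mathcal S^p}=O(\omega(\delta))$ as $\delta\to0+$; here $h\in\mathbb R$ is subtracted from every variable, so $c(\cdot-h)$ has the coefficients $c_{\mathbf k}e^{-ih(k_1+\dots+k_d)}$. **Theorem 3.4.** Let $1\le p<\infty$, $r\in\mathbb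 N$, $d\in\mathbb N$, $f\in L(\mathbb T^d)$. Let $\omega$ be continuous and nondecreasing on $[0,1]$, nonzero on $(0,1]$, with $\omega(\delta)\to0$ as $\delta\to0$, and let $\sum_{v=n+1}^\infty\frac1v\,\omega(\frac1v)=O(\omega(\frac1n))$ (Bari's condition). Consider the conditions * i) $\|f-A^\Delta_{\varrho,r}(f)\|_{\mathcal S^p}=O\big((1-\varrho)^{r-1}\omega(1-\varrho)\big)$, $\varrho\to1-$; * ii) $\|P(f^{[r]})(\varrho,\cdot)\|_{\mathcal S^p}=O\big(\frac{\omega(1-\varrho)}{1-\varrho}\big)$, $\varrho\to1-$; * iii) $f^{[r-1]}\in\mathcal S^pH^1_\omega$. Then: 1. i) and ii) are equivalent. 2. Each of i), ii) implies iii); if $r\ge2$ and $f$ is a trigonometric polynomial with $\widehat f(\mathbf k)=0$ for all $|\mathbf k|_1\ge r$, this is asserted under the additional assumption $\delta=O(\omega(\delta))$, $\delta\to0+$. 3. If $\widehat f(\mathbf k)=0$ for all $\mathbf k\notin\mathbb Z_+^d\cup\mathbb Z_-^d$ (the integer vectors with all coordinates nonnegative, respectively all negative), then iii) implies i) and ii);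 so, with the proviso in 2, all three conditions are equivalent. 4. If $f^{[r]}$ is the Fourier series of some $g\in L(\mathbb T^d)$, then ii) is equivalent to the same condition for the Poisson integral of the function $g$; if $f^{[r-1]}$ is the Fourier series of some $g\in L(\mathbb T^d)$, then iii) is equivalent to $g\in\mathcal S^pH^1_\omega$, with the increments $g-g(\cdot-h)$ formed for the function $g$. If $p\le2$ or $r=1$, then each of i), ii) implies that $f^{[r-1]}$ is the Fourier series of a function in $L(\mathbb T^d)$. -/

import Mathlib

open MeasureTheory Filter Topology Asymptotics

noncomputable section

namespace SpApprox

instance factTwoPiPos : Fact ((0 : ℝ) < 2 * Real.pi) := ⟨Real.two_pi_pos⟩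

/-- The torus `(ℝ / 2πℤ)^d`; functions on it are the functions of `d` real variables that are
`2π`-periodic in each variable. Its measure `volume` is Lebesgue measure of total mass `(2π)^d`.
The space `L(𝕋^d)` consists of the `f : Torus d → ℂ` with `Integrable f`. -/
abbrev Torus (d : ℕ) : Type := Fin d → AddCircle (2 * Real.pi)

/-- Formal trigonometric series `∑ c_k e^{i(k,x)}`, given by their coefficients. -/
abbrev TrigSeries (d : ℕ) : Type := (Fin d → ℤ) → ℂ

/-- The exponential `e^{i(k,x)}`. -/
def expo {d : ℕ} (k : Fin d → ℤ) (x : Torus d) : ℂ := ∏ j, fourier (k j) (x j)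

/-- The Fourier coefficients (the Fourier series) of a function:
`(2π)^{-d} ∫ f(x) e^{-i(k,x)} dx`. -/
def fourierSeries {d : ℕ} (f : Torus d → ℂ) : TrigSeries d :=
  fun k => ((2 * Real.pi : ℝ) : ℂ)⁻¹ ^ d * ∫ x, f x * expo (-k) x

/-- `|k|₁ = |k_1| + ... + |k_d|`. -/
def l1 {d : ℕ} (k : Fin d → ℤ) : ℕ := ∑ j, (k j).natAbs

/-- The finite set of all `k` with `|k|₁ = ν`. -/
def shell (d ν : ℕ) : Finset (Fin d → ℤ) :=
  (Fintype.piFinset fun _ => Finset.Icc (-(ν : ℤ)) (ν : ℤ)).filter fun k => l1 k = ν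

/-- The block `∑_{|k|₁ = ν} c_k e^{i(k,x)}` of a series. -/
def block {d : ℕ} (c : TrigSeries d) (ν : ℕ) (x : Torus d) : ℂ :=
  ∑ k ∈ shell d ν, c k * expo k x

/-- The norm `(∑ |c_k|^p)^{1/p}` of `𝒮^p`, with value `∞` off the space. The norm of a function
is the norm of its Fourier series. -/
def spNorm {d : ℕ} (p : ℝ) (c : TrigSeries d) : ENNReal :=
  (∑' k, ENNReal.ofReal (‖c k‖ ^ p)) ^ (1 / p)

/-- The triangular partial sum of the Fourier series of `f`, of degree less than `n`. -/
def partialSum {d : ℕ} (n : ℕ) (f : Torus d → ℂ) (x : Torus d) : ℂ :=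
  ∑ ν ∈ Finset.range n, block (fourierSeries f) ν x

/-- The multipliers `∑_{k<r} C(ν,k) (1-ρ)^k ρ^{ν-k}`; only used for `ν ≥ r`. -/
def tapCoeff (r ν : ℕ) (ρ : ℝ) : ℝ :=
  ∑ k ∈ Finset.range r, (ν.choose k : ℝ) * (1 - ρ) ^ k * ρ ^ (ν - k)

/-- The triangular Taylor–Abel–Poisson mean of `f`: the partial sum of degree `r - 1` plus
`∑_{ν ≥ r} λ_{ν,r}(ρ) H_ν(f)`. -/
def tapMean {d : ℕ} (r : ℕ) (ρ : ℝ) (f : Torus d → ℂ) (x : Torus d) : ℂ :=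
  partialSum r f x +
    ∑' m : ℕ, (tapCoeff r (m + r) ρ : ℂ) * block (fourierSeries f) (m + r) x

/-- `g` is a `ψ`-derivative of `c`: `c = ∑_{ψ(k) = 0} c_k e^{i(k,x)} + ∑ ψ(k) g_k e^{i(k,x)}`. -/
def IsPsiDeriv {d : ℕ} (ψ : (Fin d → ℤ) → ℂ) (c g : TrigSeries d) : Prop :=
  ∀ k, c k = (if ψ k = 0 then c k else 0) + ψ k * g k

/-- The `ψ`-derivative of a series. A `ψ`-derivative is determined up to its coefficients on the
zero set of `ψ`, and these are taken to be `0`. -/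
def psiDeriv {d : ℕ} (ψ : (Fin d → ℤ) → ℂ) (c : TrigSeries d) : TrigSeries d :=
  fun k => if ψ k = 0 then 0 else c k / ψ k

theorem isPsiDeriv_psiDeriv {d : ℕ} (ψ : (Fin d → ℤ) → ℂ) (c : TrigSeries d) :
    IsPsiDeriv ψ c (psiDeriv ψ c) := by
  intro k
  by_cases h : ψ k = 0
  · simp [psiDeriv, h]
  · simp [psiDeriv, h, mul_div_cancel₀]

/-- The system `ψ(k) = 0` for `|k|₁ < r` and `ψ(k) = (ν - r)! / ν!` for `|k|₁ = ν ≥ r`. -/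
def radialPsi {d : ℕ} (r : ℕ) (k : Fin d → ℤ) : ℂ :=
  if l1 k < r then 0 else ((l1 k - r).factorial : ℂ) / ((l1 k).factorial : ℂ)

/-- The derivative `f^{[r]}`, as a trigonometric series. -/
def radialDeriv {d : ℕ} (r : ℕ) (f : Torus d → ℂ) : TrigSeries d :=
  psiDeriv (radialPsi r) (fourierSeries f)

/-- The Poisson integral of a trigonometric series, `∑_ν ρ^ν ∑_{|k|₁ = ν} c_k e^{i(k,x)}`. -/
def poissonSeries {d : ℕ} (c : TrigSeries d) (ρ : ℝ) (x : Torus d) : ℂ :=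
  ∑' ν : ℕ, ((ρ ^ ν : ℝ) : ℂ) * block c ν x

/-- The multiple Poisson kernel, with all radii equal to `ρ`. -/
def poissonKernel {d : ℕ} (ρ : ℝ) (t : Torus d) : ℝ :=
  ∏ j, (1 - ρ ^ 2) / (1 - 2 * ρ * Real.Angle.cos (t j) + ρ ^ 2)

/-- The Poisson integral of a function. -/
def poissonIntegral {d : ℕ} (g : Torus d → ℂ) (ρ : ℝ) (x : Torus d) : ℂ :=
  ((2 * Real.pi : ℝ) : ℂ)⁻¹ ^ d * ∫ t, g (x + t) * (poissonKernel ρ t : ℂ)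

/-- The diagonal vector `(h, ..., h)`. -/
def diag (d : ℕ) (h : ℝ) : Torus d := fun _ => (h : AddCircle (2 * Real.pi))

/-- The first modulus of smoothness of a function, `sup_{|h| ≤ t} ‖g - g(· - h)‖`, where the
increment `h` is a number and is subtracted from all the variables. -/
def modulus {d : ℕ} (p : ℝ) (g : Torus d → ℂ) (t : ℝ) : ENNReal :=
  ⨆ (h : ℝ) (_ : |h| ≤ t), spNorm p (fourierSeries fun x => g x - g (x - diag d h))

/-- The first modulus of smoothness of a trigonometric series; the translate of
`∑ c_k e^{i(k,x)}` has the coefficients `c_k e^{-i(k,(h,...,h))}`. -/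
def modulusSeries {d : ℕ} (p : ℝ) (c : TrigSeries d) (t : ℝ) : ENNReal :=
  ⨆ (h : ℝ) (_ : |h| ≤ t), spNorm p fun k => c k - c k * expo k (-diag d h)

/-- `g ∈ 𝒮^p H^1_ω`, for a function `g`. -/
def InSpH {d : ℕ} (p : ℝ) (ω : ℝ → ℝ) (g : Torus d → ℂ) : Prop :=
  spNorm p (fourierSeries g) < ⊤ ∧
    ∃ C : ℝ, ∀ᶠ δ in 𝓝[>] (0 : ℝ), modulus p g δ ≤ ENNReal.ofReal (C * ω δ)

/-- `c ∈ 𝒮^p H^1_ω`, for a trigonometric series `c`. -/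
def SeriesInSpH {d : ℕ} (p : ℝ) (ω : ℝ → ℝ) (c : TrigSeries d) : Prop :=
  spNorm p c < ⊤ ∧
    ∃ C : ℝ, ∀ᶠ δ in 𝓝[>] (0 : ℝ), modulusSeries p c δ ≤ ENNReal.ofReal (C * ω δ)

/-- `‖F(ρ,·)‖_{𝒮^p} = O(φ(ρ))` as `ρ → 1-`. -/
def SpBigO {d : ℕ} (p : ℝ) (F : ℝ → Torus d → ℂ) (φ : ℝ → ℝ) : Prop :=
  ∃ C : ℝ, ∀ᶠ ρ in 𝓝[<] (1 : ℝ),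
    spNorm p (fourierSeries (F ρ)) ≤ ENNReal.ofReal (C * φ ρ)

/-- Conditions 1)–4) on a majorant on `[0,1]`. -/
structure IsMajorant (ω : ℝ → ℝ) : Prop where
  continuousOn : ContinuousOn ω (Set.Icc 0 1)
  monotoneOn : MonotoneOn ω (Set.Icc 0 1)
  ne_zero : ∀ δ ∈ Set.Ioc (0 : ℝ) 1, ω δ ≠ 0
  tendsto_zero : Tendsto ω (𝓝[>] 0) (𝓝 0)

/-- Bari's condition `∑_{v>n} ω(1/v)/v = O(ω(1/n))`. -/
def BariCondition (ω : ℝ → ℝ) : Prop :=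
  Summable (fun v : ℕ => 1 / (v : ℝ) * ω (1 / (v : ℝ))) ∧
    (fun n : ℕ => ∑' m : ℕ, 1 / ((n + 1 + m : ℕ) : ℝ) * ω (1 / ((n + 1 + m : ℕ) : ℝ)))
      =O[atTop] fun n : ℕ => ω (1 / (n : ℝ))

/-- The Fourier coefficients vanish off `ℤ_+^d ∪ ℤ_-^d`, the set of integer vectors that have
all their coordinates nonnegative or all negative. -/
def SpectrumInY {d : ℕ} (f : Torus d → ℂ) : Prop :=
  ∀ k : Fin d → ℤ, ¬ ((∀ j, 0 ≤ k j) ∨ (∀ j, k j < 0)) → fourierSeries f k = 0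

/-- `‖f - A_{ρ,r}(f)‖ = O((1-ρ)^{r-1} ω(1-ρ))`. -/
def ApproxRate {d : ℕ} (p : ℝ) (r : ℕ) (ω : ℝ → ℝ) (f : Torus d → ℂ) : Prop :=
  SpBigO p (fun ρ x => f x - tapMean r ρ f x) fun ρ => (1 - ρ) ^ (r - 1) * ω (1 - ρ)

/-- `‖P(f^{[r]})(ρ,·)‖ = O(ω(1-ρ)/(1-ρ))`. -/
def PoissonRate {d : ℕ} (p : ℝ) (r : ℕ) (ω : ℝ → ℝ) (f : Torus d → ℂ) : Prop :=
  SpBigO p (poissonSeries (radialDeriv r f)) fun ρ => ω (1 - ρ) / (1 - ρ)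

end SpApprox

end

open scoped ENNReal

/-! Every operator involved is a Fourier multiplier, so with `δ = 1 - ρ` and `ν = |k|₁` the three
conditions bound weighted `ℓ^p` norms of the coefficients of `f`. The weights are `1 - λ_{ν,r}(1-δ)`
in i), `ν(ν-1)⋯(ν-r+1)(1-δ)^ν` in ii), and `|1 - e^{-ih(k_1+⋯+k_d)}|` applied to `f^{[r-1]}` in
iii).

i) ⇒ ii) is termwise: `λ_{ν,r}` is a partial sum of the binomial expansion of `((1-ρ)+ρ)^ν = 1`, so
`1 - λ_{ν,r}` is at least the next term, `choose_mul_le_one_sub_tapCoeff`.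

ii) ⇒ i): the `ρ`-derivative of `λ_{ν,r}` is a single term (`hasDerivAt_tapCoeff`), so its increment
between `1 - δ/2^j` and `1 - δ/2^(j+1)` is bounded by the weight of ii). These increments telescope
to `1 - λ_{ν,r}(1-δ)`. Minkowski's inequality and `∑ ω(δ/2^j) = O(ω(δ))`, the dyadic form of Bari's
condition, finish the argument (`spNorm_one_sub_tapCoeff_le`).

ii) ⇒ iii): the same lemma with order one and the degree `ν - (r-1)` controls `1 - (1-δ)^(ν-r+1)` on
`f^{[r-1]}`. For `ν ≥ r` this factor dominates `min(2, νδ)`, hence the increments. It vanishes on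
the shell `ν = r - 1`, where the increment is only `O(δ)`; this is the source of the proviso `δ =
O(ω(δ))`, which is automatic as soon as `f^{[r]} ≠ 0`.

iii) ⇒ ii): for coordinates of one sign `|k_1+⋯+k_d| = ν`, so one of the increments with step
`δ/2^j` is large enough to dominate the weight of ii); summing over all `j` uses Bari's condition
again.

The rest identifies the Fourier series of the means, Poisson integrals and translates, and realises
`f^{[r-1]}` as a function by Riesz–Fischer. -/

noncomputable section

namespace SpApprox

/-! ### Weighted `ℓ^p` norms and Minkowski's inequality -/

/-- The `ℓ^p` norm of a family of extended nonnegative numbers. -/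
def ellNorm {ι : Type*} (p : ℝ) (u : ι → ℝ≥0∞) : ℝ≥0∞ := (∑' k, u k ^ p) ^ (1 / p)

theorem ellNorm_mono {ι : Type*} {p : ℝ} (hp : 0 ≤ p) {u v : ι → ℝ≥0∞} (h : ∀ k, u k ≤ v k) :
    ellNorm p u ≤ ellNorm p v :=
  ENNReal.rpow_le_rpow (ENNReal.tsum_le_tsum fun k => ENNReal.rpow_le_rpow (h k) hp)
    (by positivity)

theorem ellNorm_const_mul {ι : Type*} {p : ℝ} (hp : 0 < p) (a : ℝ≥0∞) (u : ι → ℝ≥0∞) :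
    ellNorm p (fun k => a * u k) = a * ellNorm p u := by
  unfold ellNorm
  simp_rw [ENNReal.mul_rpow_of_nonneg _ _ hp.le]
  rw [ENNReal.tsum_mul_left, ENNReal.mul_rpow_of_nonneg _ _ (by positivity), ← ENNReal.rpow_mul,
    mul_one_div_cancel hp.ne', ENNReal.rpow_one]

theorem ellNorm_add_le {ι : Type*} {p : ℝ} (hp : 1 ≤ p) (u v : ι → ℝ≥0∞) :
    ellNorm p (fun k => u k + v k) ≤ ellNorm p u + ellNorm p v := by
  let _ : MeasurableSpace ι := ⊤
  have := ENNReal.lintegral_Lp_add_le (μ := Measure.count) (f := u) (g := v)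
    (measurable_from_top).aemeasurable (measurable_from_top).aemeasurable hp
  simpa [lintegral_count, ellNorm] using this

theorem ellNorm_sum_le {ι κ : Type*} {p : ℝ} (hp : 1 ≤ p) (s : Finset κ) (u : κ → ι → ℝ≥0∞) :
    ellNorm p (fun k => ∑ j ∈ s, u j k) ≤ ∑ j ∈ s, ellNorm p (u j) := by
  classical
  have hp0 : 0 < p := by linarith
  induction s using Finset.induction_on with
  | empty => simp [ellNorm, ENNReal.zero_rpow_of_pos hp0, hp0]
  | insert a s ha ih =>
    simp_rw [Finset.sum_insert ha]
    exact (ellNorm_add_le hp _ _).trans (by gcongr)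

/-- The countable Minkowski inequality follows from the finite one by restricting to finitely many
indices `k`, where the limit in `j` may be taken inside. Extended values make convergence hypotheses
superfluous. -/
theorem ellNorm_tsum_le {ι : Type*} {p : ℝ} (hp : 1 ≤ p) (u : ℕ → ι → ℝ≥0∞) :
    ellNorm p (fun k => ∑' j, u j k) ≤ ∑' j, ellNorm p (u j) := by
  have hp0 : 0 < p := by linarith
  unfold ellNorm
  rw [one_div, ENNReal.rpow_inv_le_iff hp0, ENNReal.tsum_eq_iSup_sum]
  refine iSup_le fun s => ?_
  refine le_of_tendsto' (tendsto_finsetSum s fun k _ =>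
    (ENNReal.tendsto_nat_tsum fun j => u j k).ennrpow_const p) fun n => ?_
  refine (ENNReal.sum_le_tsum s).trans ?_
  rw [← ENNReal.rpow_inv_le_iff hp0, ← one_div]
  exact (ellNorm_sum_le hp (Finset.range n) u).trans (ENNReal.sum_le_tsum _)

section spNorm
variable {d : ℕ} {p : ℝ}

theorem spNorm_eq_ellNorm (hp : 1 ≤ p) (c : TrigSeries d) :
    spNorm p c = ellNorm p fun k => ‖c k‖ₑ := by
  unfold spNorm ellNorm
  congr 2 with k
  beta_reduce
  rw [← ofReal_norm, ENNReal.ofReal_rpow_of_nonneg (norm_nonneg _) (by linarith)]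

theorem spNorm_le_const_mul (hp : 1 ≤ p) {b c : TrigSeries d} {t : ℝ}
    (h : ∀ k, ‖b k‖ ≤ t * ‖c k‖) : spNorm p b ≤ ENNReal.ofReal t * spNorm p c := by
  rw [spNorm_eq_ellNorm hp, spNorm_eq_ellNorm hp, ← ellNorm_const_mul (by linarith)]
  refine ellNorm_mono (by linarith) fun k => ?_
  rw [← ofReal_norm, ← ofReal_norm,
    ← ENNReal.ofReal_mul' (norm_nonneg _)]
  exact ENNReal.ofReal_le_ofReal (h k)

theorem spNorm_le_add (hp : 1 ≤ p) {a b c : TrigSeries d} (h : ∀ k, ‖a k‖ ≤ ‖b k‖ + ‖c k‖) :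
    spNorm p a ≤ spNorm p b + spNorm p c := by
  rw [spNorm_eq_ellNorm hp, spNorm_eq_ellNorm hp, spNorm_eq_ellNorm hp]
  refine (ellNorm_mono (by linarith) fun k => ?_).trans (ellNorm_add_le hp _ _)
  simp only [← ofReal_norm]
  rw [← ENNReal.ofReal_add (norm_nonneg _) (norm_nonneg _)]
  exact ENNReal.ofReal_le_ofReal (h k)

theorem spNorm_le_tsum (hp : 1 ≤ p) {c : TrigSeries d} {t : ℕ → ℝ} {b : ℕ → TrigSeries d}
    (h : ∀ k, ‖c k‖ₑ ≤ ∑' j, ENNReal.ofReal (t j) * ‖b j k‖ₑ) :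
    spNorm p c ≤ ∑' j, ENNReal.ofReal (t j) * spNorm p (b j) := by
  simp_rw [spNorm_eq_ellNorm hp, ← ellNorm_const_mul (by linarith : 0 < p)]
  exact (ellNorm_mono (by linarith) h).trans (ellNorm_tsum_le hp _)

theorem enorm_le_spNorm (hp : 1 ≤ p) (c : TrigSeries d) (k : Fin d → ℤ) :
    ‖c k‖ₑ ≤ spNorm p c := by
  have hp0 : 0 < p := by linarith
  rw [spNorm_eq_ellNorm hp, ellNorm, one_div, ENNReal.le_rpow_inv_iff hp0]
  exact ENNReal.le_tsum (f := fun k => ‖c k‖ₑ ^ p) k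

theorem spNorm_lt_top_of_finite (hp : 1 ≤ p) {c : TrigSeries d} {s : Finset (Fin d → ℤ)}
    (h : ∀ k ∉ s, c k = 0) : spNorm p c < ⊤ := by
  have hp0 : 0 < p := by linarith
  rw [spNorm_eq_ellNorm hp, ellNorm]
  refine ENNReal.rpow_lt_top_of_nonneg (by positivity) ?_
  rw [tsum_eq_sum (s := s) (by intro k hk; simp [h k hk, hp0])]
  exact (ENNReal.sum_lt_top.2 fun k _ =>
    ENNReal.rpow_lt_top_of_nonneg hp0.le enorm_ne_top).ne

end spNorm

/-! ### Bari's condition along dyadic scales -/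

section majorant
variable {ω : ℝ → ℝ}

theorem IsMajorant.pos (hω : IsMajorant ω) {δ : ℝ} (h0 : 0 < δ) (h1 : δ ≤ 1) : 0 < ω δ := by
  refine lt_of_le_of_ne ?_ (hω.ne_zero δ ⟨h0, h1⟩).symm
  refine le_of_tendsto hω.tendsto_zero ?_
  filter_upwards [Ioo_mem_nhdsGT h0] with s hs
  exact hω.monotoneOn ⟨hs.1.le, hs.2.le.trans h1⟩ ⟨h0.le, h1⟩ hs.2.le

/-- The block `(2^j m, 2^(j+1) m]` has `2^j m` integers, and by monotonicity each term is at least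
the one at its right end. The block sum is therefore at least half of `ω(1/(2^(j+1) m))`. -/
theorem sum_dyadic_le (hω : IsMajorant ω) {m : ℕ} (hm : 1 ≤ m) (J : ℕ) :
    ∑ j ∈ Finset.range J, ω (1 / (2 ^ (j + 1) * m : ℝ)) ≤
      2 * ∑ v ∈ Finset.Ioc m (2 ^ J * m), 1 / (v : ℝ) * ω (1 / (v : ℝ)) := by
  induction J with
  | zero => simp
  | succ J ih =>
    have hm' : (1 : ℝ) ≤ m := by exact_mod_cast hm
    have h2 : (1 : ℝ) ≤ 2 ^ J := one_le_pow₀ (by norm_num)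
    have h1 : m ≤ 2 ^ J * m := Nat.le_mul_of_pos_left _ (by positivity)
    have h3 : 2 ^ J * m ≤ 2 ^ (J + 1) * m := Nat.mul_le_mul_right _ (by gcongr <;> omega)
    rw [Finset.sum_range_succ, ← Finset.sum_Ioc_consecutive _ h1 h3, mul_add]
    refine add_le_add ih ?_
    have hterm : ∀ v ∈ Finset.Ioc (2 ^ J * m) (2 ^ (J + 1) * m),
        1 / (2 ^ (J + 1) * m : ℝ) * ω (1 / (2 ^ (J + 1) * m : ℝ)) ≤
          1 / (v : ℝ) * ω (1 / (v : ℝ)) := by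
      intro v hv
      rw [Finset.mem_Ioc] at hv
      have hv0 : (1 : ℝ) ≤ v := by exact_mod_cast (hm.trans h1).trans hv.1.le
      have hv2 : (v : ℝ) ≤ 2 ^ (J + 1) * m := by exact_mod_cast hv.2
      have hle : 1 / (2 ^ (J + 1) * m : ℝ) ≤ 1 / (v : ℝ) :=
        one_div_le_one_div_of_le (by linarith) hv2
      have hv1 : 1 / (v : ℝ) ≤ 1 := by rw [div_le_one (by linarith)]; exact hv0
      have hpos : 0 < 1 / (2 ^ (J + 1) * m : ℝ) := by positivity
      exact mul_le_mul hle
        (hω.monotoneOn ⟨hpos.le, hle.trans hv1⟩ ⟨by positivity, hv1⟩ hle)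
        (hω.pos hpos (hle.trans hv1)).le (by positivity)
    have hsum := Finset.card_nsmul_le_sum _ _ _ hterm
    have hcard : (Finset.Ioc (2 ^ J * m) (2 ^ (J + 1) * m)).card = 2 ^ J * m := by
      rw [Nat.card_Ioc, pow_succ]; ring_nf; omega
    rw [hcard, nsmul_eq_mul] at hsum
    refine le_trans (le_of_eq ?_) (mul_le_mul_of_nonneg_left hsum (by norm_num : (0 : ℝ) ≤ 2))
    push_cast
    field_simp
    ring

/-- The dyadic form of Bari's condition. -/
theorem BariCondition.dyadic (hω : IsMajorant ω) (hB : BariCondition ω) :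
    ∃ C : ℝ, 0 < C ∧ ∀ᶠ δ in 𝓝[>] (0 : ℝ),
      ∑' j : ℕ, ENNReal.ofReal (ω (δ / 2 ^ j)) ≤ ENNReal.ofReal (C * ω δ) := by
  obtain ⟨hs, hO⟩ := hB
  obtain ⟨C, hC0, hC⟩ := hO.exists_pos
  rw [isBigOWith_iff] at hC
  obtain ⟨N, hN⟩ := eventually_atTop.1 hC
  refine ⟨1 + 2 * (1 + C), by positivity, ?_⟩
  filter_upwards [Ioo_mem_nhdsGT (show (0 : ℝ) < 1 / (N + 2) by positivity)] with δ hδ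
  obtain ⟨hδ0, hδN⟩ := hδ
  have hδinv : (N + 2 : ℝ) < 1 / δ := by
    rw [lt_div_iff₀ hδ0]; rw [lt_div_iff₀ (by positivity)] at hδN; linarith
  -- Since `1/(m+1) ≤ δ < 1/m`, Bari's condition is used at `m + 1`, where `ω(1/(m+1)) ≤ ω(δ)`,
  -- while the dyadic points are compared with those starting from `1/m`.
  obtain ⟨m, hm1, hm2⟩ : ∃ m : ℕ, (m : ℝ) < 1 / δ ∧ 1 / δ ≤ m + 1 := by
    have : 1 ≤ ⌈1 / δ⌉₊ := Nat.one_le_ceil_iff.2 (by positivity)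
    refine ⟨⌈1 / δ⌉₊ - 1, Nat.lt_ceil.1 (by omega), ?_⟩
    rw [Nat.cast_sub this]; simpa using Nat.le_ceil _
  have hmN : N + 1 ≤ m := by
    have : (N + 1 : ℝ) < m + 0 := by linarith
    exact_mod_cast (by linarith : (N + 1 : ℝ) ≤ m)
  have hm0 : (1 : ℝ) ≤ m := by exact_mod_cast (by omega : 1 ≤ m)
  have hδ1 : δ ≤ 1 := by
    refine hδN.le.trans ?_
    rw [div_le_one (by positivity)]
    have : (0 : ℝ) ≤ N := Nat.cast_nonneg N
    linarith
  have hδm : 1 / (m + 1 : ℝ) ≤ δ := by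
    rw [div_le_iff₀ (by positivity)]; rw [div_le_iff₀ hδ0] at hm2; linarith
  have hωm : ω (1 / (m + 1 : ℝ)) ≤ ω δ :=
    hω.monotoneOn ⟨by positivity, hδm.trans hδ1⟩ ⟨hδ0.le, hδ1⟩ hδm
  have hωm0 : 0 < ω (1 / (m + 1 : ℝ)) := hω.pos (by positivity) (hδm.trans hδ1)
  have hωδ := hω.pos hδ0 hδ1
  set F : ℕ → ℝ := fun v => 1 / (v : ℝ) * ω (1 / (v : ℝ)) with hF
  have hF0 : ∀ v, 1 ≤ v → 0 ≤ F v := fun v hv => by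
    have hv' : (1 : ℝ) ≤ v := by exact_mod_cast hv
    have : 1 / (v : ℝ) ≤ 1 := by rw [div_le_one (by linarith)]; exact hv'
    exact mul_nonneg (by positivity) (hω.pos (by positivity) this).le
  have htail : ∀ M, ∑ v ∈ Finset.Ioc m M, F v ≤ (1 + C) * ω δ := by
    intro M
    have h1 : ∑' i : ℕ, F (m + 1 + 1 + i) ≤ C * ω (1 / (m + 1 : ℝ)) := by
      have := hN (m + 1) (by omega)
      push_cast at this
      rw [Real.norm_of_nonneg hωm0.le] at this
      refine (le_trans (le_of_eq ?_) (le_abs_self _)).trans this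
      simp [hF]
    have hsF : Summable fun i : ℕ => F (m + 1 + 1 + i) := by
      simpa only [add_comm] using (summable_nat_add_iff (m + 1 + 1)).2 hs
    have h2 : ∑ v ∈ Finset.Ioc m M, F v ≤ F (m + 1) + ∑' i : ℕ, F (m + 1 + 1 + i) := by
      have h3 : ∑ v ∈ Finset.Ioc m M, F v ≤ ∑ v ∈ Finset.Ico (m + 1) (m + 1 + (M + 1)), F v := by
        refine Finset.sum_le_sum_of_subset_of_nonneg ?_ ?_
        · intro v hv
          rw [Finset.mem_Ioc] at hv
          rw [Finset.mem_Ico]; omega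
        · intro v hv _
          rw [Finset.mem_Ico] at hv
          exact hF0 v (by omega)
      refine h3.trans ?_
      rw [Finset.sum_Ico_eq_sum_range, Nat.add_sub_cancel_left, Finset.sum_range_succ', add_comm]
      refine add_le_add (le_of_eq (by simp)) ?_
      have := hsF.sum_le_tsum (Finset.range M) (fun i _ => hF0 _ (by omega))
      refine le_trans (le_of_eq (Finset.sum_congr rfl fun i _ => ?_)) this
      congr 1; omega
    have h4 : F (m + 1) ≤ ω (1 / (m + 1 : ℝ)) := by
      simp only [hF]; push_cast
      refine mul_le_of_le_one_left hωm0.le (hδm.trans hδ1)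
    nlinarith
  have hpart : ∀ J, ∑ j ∈ Finset.range J, ω (δ / 2 ^ j) ≤ (1 + 2 * (1 + C)) * ω δ := by
    intro J
    have hnn : ∀ j : ℕ, 0 ≤ ω (δ / 2 ^ j) := fun j =>
      (hω.pos (by positivity) ((div_le_self hδ0.le (one_le_pow₀ (by norm_num))).trans hδ1)).le
    have h1 : ∑ j ∈ Finset.range J, ω (δ / 2 ^ j) ≤
        ∑ j ∈ Finset.range (J + 1), ω (δ / 2 ^ j) :=
      Finset.sum_le_sum_of_subset_of_nonneg (Finset.range_subset_range.2 (by omega))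
        fun j _ _ => hnn j
    refine h1.trans ?_
    rw [Finset.sum_range_succ', pow_zero, div_one, add_mul, one_mul, add_comm]
    refine add_le_add le_rfl ?_
    have h2 : ∑ j ∈ Finset.range J, ω (δ / 2 ^ (j + 1)) ≤
        ∑ j ∈ Finset.range J, ω (1 / (2 ^ (j + 1) * m : ℝ)) := by
      refine Finset.sum_le_sum fun j _ => ?_
      have hle : δ / 2 ^ (j + 1) ≤ 1 / (2 ^ (j + 1) * m : ℝ) := by
        rw [div_le_div_iff₀ (by positivity) (by positivity)]
        rw [lt_div_iff₀ hδ0] at hm1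
        have : (0 : ℝ) < 2 ^ (j + 1) := by positivity
        nlinarith
      have hle1 : 1 / (2 ^ (j + 1) * m : ℝ) ≤ 1 := by
        rw [div_le_one (by positivity)]
        have : (1 : ℝ) ≤ 2 ^ (j + 1) := one_le_pow₀ (by norm_num)
        nlinarith
      exact hω.monotoneOn ⟨by positivity, hle.trans hle1⟩ ⟨by positivity, hle1⟩ hle
    refine h2.trans ((sum_dyadic_le hω (by omega) J).trans ?_)
    have := htail (2 ^ J * m)
    linarith
  refine ENNReal.tsum_le_of_sum_range_le fun J => ?_
  rw [← ENNReal.ofReal_sum_of_nonneg]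
  · exact ENNReal.ofReal_le_ofReal (hpart J)
  · exact fun j _ =>
      (hω.pos (by positivity) ((div_le_self hδ0.le (one_le_pow₀ (by norm_num))).trans hδ1)).le

end majorant

/-! ### The multipliers as partial binomial sums -/

section tapCoeff

theorem sum_choose_range {ν n : ℕ} (h : ν < n) (ρ : ℝ) :
    ∑ k ∈ Finset.range n, (ν.choose k : ℝ) * (1 - ρ) ^ k * ρ ^ (ν - k) = 1 := by
  rw [← Finset.sum_subset (Finset.range_subset_range.2 h)]
  · have := add_pow (1 - ρ) ρ ν
    rw [sub_add_cancel, one_pow] at this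
    refine Eq.trans (Finset.sum_congr rfl fun k _ => ?_) this.symm
    ring
  · intro k _ hk
    rw [Finset.mem_range, not_lt] at hk
    rw [Nat.choose_eq_zero_of_lt (by omega)]; simp

/-- For `ν < r` the binomial expansion is complete. Hence the partial sum in the mean obeys the same
multiplier formula as the rest. -/
theorem tapCoeff_of_lt {r ν : ℕ} (h : ν < r) (ρ : ℝ) : tapCoeff r ν ρ = 1 :=
  sum_choose_range h ρ

theorem tapCoeff_nonneg (r ν : ℕ) {ρ : ℝ} (h0 : 0 ≤ ρ) (h1 : ρ ≤ 1) : 0 ≤ tapCoeff r ν ρ := by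
  have : 0 ≤ 1 - ρ := by linarith
  exact Finset.sum_nonneg fun k _ => by positivity

theorem tapCoeff_le_one (r ν : ℕ) {ρ : ℝ} (h0 : 0 ≤ ρ) (h1 : ρ ≤ 1) : tapCoeff r ν ρ ≤ 1 := by
  have : 0 ≤ 1 - ρ := by linarith
  rw [← sum_choose_range (show ν < max r (ν + 1) by omega) ρ]
  exact Finset.sum_le_sum_of_subset_of_nonneg (Finset.range_subset_range.2 (le_max_left _ _))
    fun k _ _ => by positivity

theorem choose_mul_le_one_sub_tapCoeff (r ν : ℕ) {ρ : ℝ} (h0 : 0 ≤ ρ) (h1 : ρ ≤ 1) :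
    (ν.choose r : ℝ) * (1 - ρ) ^ r * ρ ^ (ν - r) ≤ 1 - tapCoeff r ν ρ := by
  have := tapCoeff_le_one (r + 1) ν h0 h1
  rw [tapCoeff, Finset.sum_range_succ] at this
  rw [tapCoeff]; linarith

theorem tapCoeff_one_right {r : ℕ} (hr : 1 ≤ r) (ν : ℕ) : tapCoeff r ν 1 = 1 := by
  obtain ⟨s, rfl⟩ := Nat.exists_eq_add_of_le' hr
  simp [tapCoeff, Finset.sum_range_succ']

theorem tapCoeff_one_left (ν : ℕ) (ρ : ℝ) : tapCoeff 1 ν ρ = ρ ^ ν := by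
  simp [tapCoeff]

/-- Differentiating term by term telescopes: each new binomial term contributes a part that cancels
the derivative accumulated so far, through `(r+2) C(ν,r+2) = (ν-r-1) C(ν,r+1)`. -/
theorem hasDerivAt_tapCoeff (r ν : ℕ) (t : ℝ) :
    HasDerivAt (tapCoeff (r + 1) ν)
      ((r + 1 : ℝ) * ν.choose (r + 1) * (1 - t) ^ r * t ^ (ν - (r + 1))) t := by
  induction r with
  | zero =>
    have := hasDerivAt_pow ν t
    rw [show tapCoeff (0 + 1) ν = fun t => t ^ ν from funext (tapCoeff_one_left ν)]
    refine this.congr_deriv ?_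
    simp
  | succ r ih =>
    have hsub : HasDerivAt (fun t : ℝ => 1 - t) (-1) t := by
      simpa using (hasDerivAt_id t).const_sub 1
    have h2 := ((hsub.pow (r + 1)).mul (hasDerivAt_pow (ν - (r + 1)) t)).const_mul
      (ν.choose (r + 1) : ℝ)
    have h3 := ih.add h2
    have h4 : tapCoeff (r + 1 + 1) ν = tapCoeff (r + 1) ν +
        fun t => (ν.choose (r + 1) : ℝ) * ((1 - t) ^ (r + 1) * t ^ (ν - (r + 1))) := by
      funext s
      simp only [tapCoeff, Pi.add_apply]
      rw [Finset.sum_range_succ]; ring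
    rw [h4]
    refine h3.congr_deriv ?_
    have hch : ((ν.choose (r + 1 + 1) : ℕ) : ℝ) * (r + 1 + 1 : ℝ) =
        ν.choose (r + 1) * ((ν - (r + 1) : ℕ) : ℝ) := by
      exact_mod_cast Nat.choose_succ_right_eq ν (r + 1)
    have he : ν - (r + 1) - 1 = ν - (r + 1 + 1) := by omega
    simp only [Pi.pow_apply, he]
    push_cast
    linear_combination (-(1 - t) ^ (r + 1) * t ^ (ν - (r + 1 + 1))) * hch

theorem continuous_tapCoeff (r ν : ℕ) : Continuous (tapCoeff r ν) := by
  unfold tapCoeff; fun_prop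

/-- Mean value inequality: on `[s,t]` the derivative is at most its expression with `1 - s` and `t`
inserted, and `t - s ≤ 1 - s` supplies the last power. The factor `2^r` pays for raising the
exponent `ν - r` to `ν`, as `t ≥ 1/2`. -/
theorem tapCoeff_sub_le {r : ℕ} (hr : 1 ≤ r) (ν : ℕ) {s t : ℝ} (hs : 0 ≤ s) (hst : s ≤ t)
    (ht : t ≤ 1) (ht2 : 1 / 2 ≤ t) :
    tapCoeff r ν t - tapCoeff r ν s ≤
      2 ^ r * (1 - s) ^ r * (ν.descFactorial r * t ^ ν) := by
  obtain ⟨q, rfl⟩ := Nat.exists_eq_add_of_le' hr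
  have h1s : 0 ≤ 1 - s := by linarith
  have ht0 : 0 ≤ t := by linarith
  have hmv := Convex.image_sub_le_mul_sub_of_deriv_le (convex_Icc s t)
    (f := tapCoeff (q + 1) ν) (continuous_tapCoeff _ _).continuousOn
    (fun x _ => (hasDerivAt_tapCoeff q ν x).differentiableAt.differentiableWithinAt)
    (C := (q + 1 : ℝ) * ν.choose (q + 1) * (1 - s) ^ q * t ^ (ν - (q + 1)))
    (by
      intro x hx
      rw [interior_Icc] at hx
      rw [(hasDerivAt_tapCoeff q ν x).deriv]
      have h0x : 0 ≤ x := hs.trans hx.1.le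
      have h1x : 0 ≤ 1 - x := by linarith [hx.2]
      gcongr
      · exact hx.1.le
      · exact hx.2.le)
    s (Set.left_mem_Icc.2 hst) t (Set.right_mem_Icc.2 hst) hst
  refine hmv.trans ?_
  have hdesc : (q + 1 : ℝ) * ν.choose (q + 1) ≤ ν.descFactorial (q + 1) := by
    rw [Nat.descFactorial_eq_factorial_mul_choose]
    exact_mod_cast Nat.mul_le_mul_right _ (Nat.self_le_factorial (q + 1))
  rcases lt_or_ge ν (q + 1) with hlt | hge
  · rw [Nat.choose_eq_zero_of_lt hlt]
    simp only [Nat.cast_zero, mul_zero, zero_mul]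
    positivity
  · have hpow : t ^ (ν - (q + 1)) ≤ 2 ^ (q + 1) * t ^ ν := by
      have h1 : (1 : ℝ) ≤ (2 * t) ^ (q + 1) := one_le_pow₀ (by linarith)
      have h2 : t ^ ν = t ^ (ν - (q + 1)) * t ^ (q + 1) := by
        rw [← pow_add, Nat.sub_add_cancel hge]
      have h3 := le_mul_of_one_le_right (show 0 ≤ t ^ (ν - (q + 1)) by positivity) h1
      rw [mul_pow] at h3
      rw [h2]; linarith
    calc (q + 1 : ℝ) * ν.choose (q + 1) * (1 - s) ^ q * t ^ (ν - (q + 1)) * (t - s)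
        ≤ ν.descFactorial (q + 1) * (1 - s) ^ q * (2 ^ (q + 1) * t ^ ν) * (1 - s) := by
          have : 0 ≤ t - s := by linarith
          gcongr
      _ = _ := by ring

theorem hasSum_tapCoeff_sub {r : ℕ} (hr : 1 ≤ r) (ν : ℕ) {δ : ℝ}
    (hmono : ∀ j : ℕ, 0 ≤ tapCoeff r ν (1 - δ / 2 ^ (j + 1)) - tapCoeff r ν (1 - δ / 2 ^ j)) :
    HasSum (fun j : ℕ => tapCoeff r ν (1 - δ / 2 ^ (j + 1)) - tapCoeff r ν (1 - δ / 2 ^ j))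
      (1 - tapCoeff r ν (1 - δ)) := by
  rw [hasSum_iff_tendsto_nat_of_nonneg hmono]
  simp_rw [Finset.sum_range_sub fun j : ℕ => tapCoeff r ν (1 - δ / 2 ^ j)]
  rw [pow_zero, div_one]
  refine Tendsto.sub_const ?_ _
  have hlim : Tendsto (fun n : ℕ => 1 - δ / 2 ^ n) atTop (𝓝 1) := by
    have := (tendsto_pow_atTop_nhds_zero_of_lt_one (r := (1 / 2 : ℝ)) (by norm_num)
      (by norm_num)).const_mul δ
    have := this.const_sub 1
    simpa [div_eq_mul_inv] using this
  have := ((continuous_tapCoeff r ν).tendsto 1).comp hlim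
  rwa [tapCoeff_one_right hr] at this

theorem tapCoeff_mono {r : ℕ} (hr : 1 ≤ r) (ν : ℕ) {s t : ℝ} (hs : 0 ≤ s) (hst : s ≤ t)
    (ht : t ≤ 1) : tapCoeff r ν s ≤ tapCoeff r ν t := by
  obtain ⟨q, rfl⟩ := Nat.exists_eq_add_of_le' hr
  refine monotoneOn_of_deriv_nonneg (convex_Icc s t) (continuous_tapCoeff _ _).continuousOn
    (fun x _ => (hasDerivAt_tapCoeff q ν x).differentiableAt.differentiableWithinAt) ?_
    (Set.left_mem_Icc.2 hst) (Set.right_mem_Icc.2 hst) hst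
  intro x hx
  rw [interior_Icc] at hx
  rw [(hasDerivAt_tapCoeff q ν x).deriv]
  have h0x : 0 ≤ x := hs.trans hx.1.le
  have h1x : 0 ≤ 1 - x := by linarith [hx.2]
  positivity

end tapCoeff

/-! ### Summation over dyadic scales -/

theorem eventually_nhdsLT_one_iff {P : ℝ → Prop} :
    (∀ᶠ ρ in 𝓝[<] (1 : ℝ), P ρ) ↔ ∀ᶠ δ in 𝓝[>] (0 : ℝ), P (1 - δ) := by
  have h1 : Tendsto (fun x : ℝ => 1 - x) (𝓝[>] 0) (𝓝[<] 1) := by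
    refine tendsto_nhdsWithin_iff.2 ⟨?_, ?_⟩
    · exact ((continuous_const.sub continuous_id).tendsto' 0 1 (by simp)).mono_left
        nhdsWithin_le_nhds
    · filter_upwards [self_mem_nhdsWithin] with x hx
      simpa using hx
  have h2 : Tendsto (fun x : ℝ => 1 - x) (𝓝[<] 1) (𝓝[>] 0) := by
    refine tendsto_nhdsWithin_iff.2 ⟨?_, ?_⟩
    · exact ((continuous_const.sub continuous_id).tendsto' 1 0 (by simp)).mono_left
        nhdsWithin_le_nhds
    · filter_upwards [self_mem_nhdsWithin] with x hx
      simpa using hx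
  exact ⟨fun h => h1.eventually h, fun h => by simpa using h2.eventually h⟩

/-- If a property holds near `0`, it holds near `0` for all smaller positive arguments. -/
theorem eventually_forall_le {P : ℝ → Prop} (h : ∀ᶠ δ in 𝓝[>] (0 : ℝ), P δ) :
    ∀ᶠ δ in 𝓝[>] (0 : ℝ), ∀ s, 0 < s → s ≤ δ → P s := by
  obtain ⟨ε, hε, hP⟩ := mem_nhdsGT_iff_exists_Ioo_subset.1 h
  filter_upwards [Ioo_mem_nhdsGT (show (0 : ℝ) < ε from hε)] with δ hδ s hs hsδ
  exact hP ⟨hs, hsδ.trans_lt hδ.2⟩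

theorem ofReal_mul_le_abs {C x : ℝ} (hx : 0 ≤ x) :
    ENNReal.ofReal (C * x) ≤ ENNReal.ofReal (|C| * x) :=
  ENNReal.ofReal_le_ofReal (mul_le_mul_of_nonneg_right (le_abs_self C) hx)

/-- A bound for the Poisson means of the `r`-th derivative, for any degree function `m` on the
indices, gives one for the differences with the Taylor-Abel-Poisson means. -/
theorem spNorm_one_sub_tapCoeff_le {d r : ℕ} (hr : 1 ≤ r) {p : ℝ} (hp : 1 ≤ p) {ω : ℝ → ℝ}
    (hω : IsMajorant ω) (hB : BariCondition ω) (m : (Fin d → ℤ) → ℕ) (b : TrigSeries d) {C : ℝ}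
    (h : ∀ᶠ δ in 𝓝[>] (0 : ℝ),
      spNorm p (fun k => (((m k).descFactorial r * (1 - δ) ^ m k : ℝ) : ℂ) * b k) ≤
        ENNReal.ofReal (C * (ω δ / δ))) :
    ∃ C' : ℝ, ∀ᶠ δ in 𝓝[>] (0 : ℝ),
      spNorm p (fun k => ((1 - tapCoeff r (m k) (1 - δ) : ℝ) : ℂ) * b k) ≤
        ENNReal.ofReal (C' * (δ ^ (r - 1) * ω δ)) := by
  obtain ⟨D, hD0, hD⟩ := hB.dyadic hω
  -- Here `2^r` is from `tapCoeff_sub_le`, one more `2` from the mismatch between the factor `δ/2^j`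
  -- and the scale `δ/2^(j+1)` at which the hypothesis is applied, and `D` from Bari's condition.
  refine ⟨2 ^ (r + 1) * |C| * D, ?_⟩
  filter_upwards [eventually_forall_le h, hD, Ioo_mem_nhdsGT (show (0 : ℝ) < 1 / 2 by norm_num)]
    with δ hδ hDδ hδ2
  obtain ⟨hδ0, hδ2⟩ := hδ2
  have hpos : ∀ j : ℕ, 0 < δ / 2 ^ j := fun j => by positivity
  have hle : ∀ j : ℕ, δ / 2 ^ j ≤ δ := fun j => div_le_self hδ0.le (one_le_pow₀ (by norm_num))
  have hhalf : ∀ j : ℕ, δ / 2 ^ (j + 1) ≤ δ / 2 ^ j := fun j => by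
    gcongr <;> norm_num
  have hωpos : ∀ j : ℕ, 0 < ω (δ / 2 ^ j) := fun j =>
    hω.pos (hpos j) ((hle j).trans (by linarith))
  have hptw : ∀ k, ‖((1 - tapCoeff r (m k) (1 - δ) : ℝ) : ℂ) * b k‖ₑ ≤
      ∑' j : ℕ, ENNReal.ofReal (2 ^ r * (δ / 2 ^ j) ^ r) *
        ‖(((m k).descFactorial r * (1 - δ / 2 ^ (j + 1)) ^ m k : ℝ) : ℂ) * b k‖ₑ := by
    intro k
    have hmono : ∀ j : ℕ, 0 ≤
        tapCoeff r (m k) (1 - δ / 2 ^ (j + 1)) - tapCoeff r (m k) (1 - δ / 2 ^ j) := fun j =>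
      sub_nonneg.2 (tapCoeff_mono hr _ (by linarith [hle j]) (by linarith [hhalf j])
        (by linarith [hpos (j + 1)]))
    have hs := hasSum_tapCoeff_sub hr (m k) hmono
    rw [enorm_mul, ← ofReal_norm, Complex.norm_real, Real.norm_of_nonneg
      (by linarith [tapCoeff_le_one r (m k) (show 0 ≤ 1 - δ by linarith) (by linarith)]),
      ← hs.tsum_eq, ENNReal.ofReal_tsum_of_nonneg hmono hs.summable, ← ENNReal.tsum_mul_right]
    refine ENNReal.tsum_le_tsum fun j => ?_
    rw [enorm_mul, ← mul_assoc]
    gcongr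
    have h0 : 0 ≤ 1 - δ / 2 ^ (j + 1) := by linarith [hle (j + 1)]
    rw [← ofReal_norm (Complex.ofReal _), Complex.norm_real, Real.norm_of_nonneg (by positivity),
      ← ENNReal.ofReal_mul (by positivity)]
    refine ENNReal.ofReal_le_ofReal ?_
    have := tapCoeff_sub_le hr (m k) (s := 1 - δ / 2 ^ j) (t := 1 - δ / 2 ^ (j + 1))
      (by linarith [hle j]) (by linarith [hhalf j]) (by linarith [hpos (j + 1)])
      (by linarith [hle (j + 1)])
    simpa using this
  refine (spNorm_le_tsum hp hptw).trans ?_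
  calc ∑' j : ℕ, ENNReal.ofReal (2 ^ r * (δ / 2 ^ j) ^ r) * spNorm p
        (fun k => (((m k).descFactorial r * (1 - δ / 2 ^ (j + 1)) ^ m k : ℝ) : ℂ) * b k)
      ≤ ∑' j : ℕ, ENNReal.ofReal (2 ^ (r + 1) * |C| * δ ^ (r - 1)) *
          ENNReal.ofReal (ω (δ / 2 ^ (j + 1))) := by
        refine ENNReal.tsum_le_tsum fun j => ?_
        have hq : 0 ≤ ω (δ / 2 ^ (j + 1)) / (δ / 2 ^ (j + 1)) := (div_pos (hωpos _) (hpos _)).le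
        refine (mul_le_mul_right ((hδ _ (hpos (j + 1)) (hle _)).trans
          (ofReal_mul_le_abs hq)) _).trans ?_
        rw [← ENNReal.ofReal_mul (by positivity), ← ENNReal.ofReal_mul (by positivity)]
        refine ENNReal.ofReal_le_ofReal ?_
        -- One power of `δ/2^j` is kept to cancel the denominator of `ω(s)/s`; the other `r - 1`
        -- become the factor `δ^(r-1)` of the rate.
        have h1 : (δ / 2 ^ j) ^ r ≤ δ ^ (r - 1) * (δ / 2 ^ j) := by
          conv_lhs => rw [← Nat.sub_add_cancel hr, pow_succ]
          exact mul_le_mul_of_nonneg_right (pow_le_pow_left₀ (hpos j).le (hle j) _) (hpos j).le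
        calc 2 ^ r * (δ / 2 ^ j) ^ r * (|C| * (ω (δ / 2 ^ (j + 1)) / (δ / 2 ^ (j + 1))))
            ≤ 2 ^ r * (δ ^ (r - 1) * (δ / 2 ^ j)) *
              (|C| * (ω (δ / 2 ^ (j + 1)) / (δ / 2 ^ (j + 1)))) := by gcongr
          _ = _ := by field_simp; ring
    _ = ENNReal.ofReal (2 ^ (r + 1) * |C| * δ ^ (r - 1)) *
          ∑' j : ℕ, ENNReal.ofReal (ω (δ / 2 ^ (j + 1))) := ENNReal.tsum_mul_left
    _ ≤ ENNReal.ofReal (2 ^ (r + 1) * |C| * δ ^ (r - 1)) * ENNReal.ofReal (D * ω δ) := by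
        gcongr
        refine le_trans ?_ hDδ
        exact ENNReal.tsum_comp_le_tsum_of_injective (add_left_injective 1)
          (fun j => ENNReal.ofReal (ω (δ / 2 ^ j)))
    _ = _ := by
        rw [← ENNReal.ofReal_mul (by positivity)]
        congr 1; ring

/-! ### The equivalences at the level of coefficients -/

section rates

variable {d r : ℕ} {p : ℝ} {ω : ℝ → ℝ}

/-- The derivative of order `r` of a series. -/
def derivSeries (r : ℕ) (c : TrigSeries d) : TrigSeries d :=
  fun k => ((l1 k).descFactorial r : ℂ) * c k

/-- Falling factorials vanish below order `r`, so they absorb the case distinction in `radialPsi`.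
-/
theorem radialDeriv_eq (r : ℕ) (f : Torus d → ℂ) :
    radialDeriv r f = derivSeries r (fourierSeries f) := by
  funext k
  unfold radialDeriv psiDeriv radialPsi derivSeries
  by_cases h : l1 k < r
  · simp [h, Nat.descFactorial_of_lt h]
  · have h1 : ((l1 k - r).factorial : ℂ) ≠ 0 := by exact_mod_cast Nat.factorial_ne_zero _
    have h2 : ((l1 k).factorial : ℂ) ≠ 0 := by exact_mod_cast Nat.factorial_ne_zero _
    have h3 : ((l1 k - r).factorial : ℂ) * (l1 k).descFactorial r = (l1 k).factorial := by
      exact_mod_cast Nat.factorial_mul_descFactorial (not_lt.1 h)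
    rw [if_neg h, if_neg (div_ne_zero h1 h2), ← h3]
    field_simp

/-- The rate of approximation, in terms of the coefficients. -/
def CoeffApproxRate (p : ℝ) (r : ℕ) (ω : ℝ → ℝ) (c : TrigSeries d) : Prop :=
  ∃ C : ℝ, ∀ᶠ δ in 𝓝[>] (0 : ℝ),
    spNorm p (fun k => ((1 - tapCoeff r (l1 k) (1 - δ) : ℝ) : ℂ) * c k) ≤
      ENNReal.ofReal (C * (δ ^ (r - 1) * ω δ))

/-- The growth rate of the Poisson means of the derivative, in terms of the coefficients. -/
def CoeffPoissonRate (p : ℝ) (r : ℕ) (ω : ℝ → ℝ) (c : TrigSeries d) : Prop :=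
  ∃ C : ℝ, ∀ᶠ δ in 𝓝[>] (0 : ℝ),
    spNorm p (fun k => (((l1 k).descFactorial r * (1 - δ) ^ l1 k : ℝ) : ℂ) * c k) ≤
      ENNReal.ofReal (C * (ω δ / δ))

theorem CoeffPoissonRate.approxRate (hr : 1 ≤ r) (hp : 1 ≤ p) (hω : IsMajorant ω)
    (hB : BariCondition ω) {c : TrigSeries d} (h : CoeffPoissonRate p r ω c) :
    CoeffApproxRate p r ω c :=
  let ⟨_, hC⟩ := h
  spNorm_one_sub_tapCoeff_le hr hp hω hB l1 c hC

theorem CoeffApproxRate.poissonRate (hr : 1 ≤ r) (hp : 1 ≤ p) {c : TrigSeries d}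
    (h : CoeffApproxRate p r ω c) : CoeffPoissonRate p r ω c := by
  obtain ⟨C, hC⟩ := h
  refine ⟨r.factorial * C, ?_⟩
  filter_upwards [hC, Ioo_mem_nhdsGT (show (0 : ℝ) < 1 by norm_num)] with δ hδ hδ1
  obtain ⟨hδ0, hδ1⟩ := hδ1
  refine (spNorm_le_const_mul hp (t := r.factorial / δ ^ r) fun k => ?_).trans
    ((mul_le_mul_right hδ _).trans ?_)
  · rw [norm_mul, norm_mul, ← mul_assoc]
    refine mul_le_mul_of_nonneg_right ?_ (norm_nonneg _)
    have h0 : 0 ≤ 1 - δ := by linarith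
    rw [Complex.norm_real, Complex.norm_real, Real.norm_of_nonneg (by positivity),
      Real.norm_of_nonneg (by linarith [tapCoeff_le_one r (l1 k) h0 (by linarith)])]
    have h1 := choose_mul_le_one_sub_tapCoeff r (l1 k) h0 (by linarith)
    rw [sub_sub_cancel] at h1
    have h2 : (1 - δ) ^ l1 k ≤ (1 - δ) ^ (l1 k - r) :=
      pow_le_pow_of_le_one h0 (by linarith) (Nat.sub_le _ _)
    rw [div_mul_eq_mul_div, le_div_iff₀ (by positivity), Nat.descFactorial_eq_factorial_mul_choose]
    push_cast
    calc (r.factorial : ℝ) * (l1 k).choose r * (1 - δ) ^ l1 k * δ ^ r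
        ≤ (r.factorial : ℝ) * (l1 k).choose r * (1 - δ) ^ (l1 k - r) * δ ^ r := by gcongr
      _ = r.factorial * ((l1 k).choose r * δ ^ r * (1 - δ) ^ (l1 k - r)) := by ring
      _ ≤ _ := by gcongr
  · rw [← ENNReal.ofReal_mul (by positivity)]
    refine ENNReal.ofReal_le_ofReal (le_of_eq ?_)
    have : δ ^ r = δ ^ (r - 1) * δ := by rw [← pow_succ, Nat.sub_add_cancel hr]
    rw [this]
    field_simp

theorem derivSeries_eq (hr : 1 ≤ r) (c : TrigSeries d) (k : Fin d → ℤ) :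
    derivSeries r c k = ((l1 k - (r - 1) : ℕ) : ℂ) * derivSeries (r - 1) c k := by
  obtain ⟨q, rfl⟩ := Nat.exists_eq_add_of_le' hr
  simp only [derivSeries, Nat.descFactorial_succ, Nat.add_sub_cancel]
  push_cast; ring

theorem norm_descFactorial_mul_pow (c : TrigSeries d) (k : Fin d → ℤ) {δ : ℝ} (hδ : δ ≤ 1) :
    ‖(((l1 k).descFactorial r * (1 - δ) ^ l1 k : ℝ) : ℂ) * c k‖ =
      (1 - δ) ^ l1 k * ‖derivSeries r c k‖ := by
  have h0 : 0 ≤ 1 - δ := by linarith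
  rw [derivSeries, norm_mul, norm_mul, Complex.norm_real, Real.norm_of_nonneg (by positivity),
    Complex.norm_natCast]
  ring

/-- The derivative of order `r - 1` satisfies an approximation estimate of order one. -/
theorem CoeffPoissonRate.deriv_pred (hr : 1 ≤ r) (hp : 1 ≤ p) (hω : IsMajorant ω)
    (hB : BariCondition ω) {c : TrigSeries d} (h : CoeffPoissonRate p r ω c) :
    ∃ C : ℝ, ∀ᶠ δ in 𝓝[>] (0 : ℝ),
      spNorm p (fun k => ((1 - (1 - δ) ^ (l1 k - (r - 1)) : ℝ) : ℂ) * derivSeries (r - 1) c k) ≤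
        ENNReal.ofReal (C * ω δ) := by
  obtain ⟨C, hC⟩ := h
  -- For order one the multiplier is `(1-δ)^μ`, and with `μ = ν - (r-1)` its weight `μ` turns
  -- `f^{[r-1]}` into `f^{[r]}`.
  have := spNorm_one_sub_tapCoeff_le le_rfl hp hω hB (fun k => l1 k - (r - 1))
    (derivSeries (r - 1) c) (C := 2 ^ (r - 1) * C) ?_
  · simpa only [tapCoeff_one_left, Nat.sub_self, pow_zero, one_mul] using this
  filter_upwards [hC, Ioo_mem_nhdsGT (show (0 : ℝ) < 1 / 2 by norm_num)] with δ hδ hδ1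
  obtain ⟨hδ0, hδ1⟩ := hδ1
  refine (spNorm_le_const_mul hp (t := 2 ^ (r - 1)) fun k => ?_).trans
    ((mul_le_mul_right hδ _).trans ?_)
  · have h0 : 0 ≤ 1 - δ := by linarith
    rw [norm_descFactorial_mul_pow _ _ (by linarith), derivSeries_eq hr, norm_mul, norm_mul,
      Complex.norm_real, Real.norm_of_nonneg (by positivity), Complex.norm_natCast,
      Nat.descFactorial_one]
    have hpow : (1 - δ) ^ (l1 k - (r - 1)) ≤ 2 ^ (r - 1) * (1 - δ) ^ l1 k := by
      have h1 : (1 : ℝ) ≤ (2 * (1 - δ)) ^ (r - 1) := one_le_pow₀ (by linarith)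
      rw [mul_pow] at h1
      have h2 : (1 - δ) ^ (l1 k - (r - 1) + (r - 1)) ≤ (1 - δ) ^ l1 k :=
        pow_le_pow_of_le_one h0 (by linarith) (by omega)
      have h3 := le_mul_of_one_le_right (show 0 ≤ (1 - δ) ^ (l1 k - (r - 1)) by positivity) h1
      refine h3.trans ?_
      rw [pow_add] at h2
      calc (1 - δ) ^ (l1 k - (r - 1)) * (2 ^ (r - 1) * (1 - δ) ^ (r - 1))
          = 2 ^ (r - 1) * ((1 - δ) ^ (l1 k - (r - 1)) * (1 - δ) ^ (r - 1)) := by ring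
        _ ≤ _ := by gcongr
    calc ((l1 k - (r - 1) : ℕ) : ℝ) * (1 - δ) ^ (l1 k - (r - 1)) * ‖derivSeries (r - 1) c k‖
        ≤ ((l1 k - (r - 1) : ℕ) : ℝ) * (2 ^ (r - 1) * (1 - δ) ^ l1 k) *
          ‖derivSeries (r - 1) c k‖ := by gcongr
      _ = _ := by ring
  · rw [← ENNReal.ofReal_mul (by positivity), mul_assoc]

theorem one_sub_pow_mul_le_one (μ : ℕ) {δ : ℝ} (h0 : 0 < δ) (h1 : δ ≤ 1) :
    (1 - δ) ^ μ * (1 + μ * δ) ≤ 1 := by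
  have hb := one_add_mul_le_pow (show (-2 : ℝ) ≤ δ by linarith) μ
  calc (1 - δ) ^ μ * (1 + μ * δ) ≤ (1 - δ) ^ μ * (1 + δ) ^ μ := by
        have : 0 ≤ 1 - δ := by linarith
        gcongr
    _ = (1 - δ ^ 2) ^ μ := by rw [← mul_pow]; ring
    _ ≤ 1 := pow_le_one₀ (by nlinarith) (by nlinarith)

/-- With `x = μδ`, the preceding bound gives `1 - (1-δ)^μ ≥ x/(1+x)`, and `min(2,x) ≤ 3x/(1+x)` with
equality at `x = 2`. -/
theorem min_le_one_sub_pow (μ : ℕ) {δ : ℝ} (h0 : 0 < δ) (h1 : δ ≤ 1) :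
    min 2 (μ * δ) ≤ 3 * (1 - (1 - δ) ^ μ) := by
  have h := one_sub_pow_mul_le_one μ h0 h1
  have hx : 0 ≤ (μ : ℝ) * δ := by positivity
  have hy : 0 ≤ (1 - δ) ^ μ := by
    have : 0 ≤ 1 - δ := by linarith
    positivity
  generalize (μ : ℝ) * δ = x at *
  generalize (1 - δ) ^ μ = y at *
  have hy' : y ≤ 1 / (1 + x) := by rw [le_div_iff₀ (by linarith)]; exact h
  have hle : min 2 x ≤ 3 * (1 - 1 / (1 + x)) := by
    have : 1 - 1 / (1 + x) = x / (1 + x) := by field_simp; ring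
    rw [this, mul_div_assoc', le_div_iff₀ (by linarith)]
    rcases le_total x 2 with hx2 | hx2
    · rw [min_eq_right hx2]; nlinarith
    · rw [min_eq_left hx2]; linarith
  linarith

/-- The `𝒮^p` norm of the low-order part of a series is finite. -/
theorem spNorm_truncate_lt_top (hp : 1 ≤ p) (n : ℕ) (c : TrigSeries d) :
    spNorm p (fun k => if l1 k < n then c k else 0) < ⊤ := by
  refine spNorm_lt_top_of_finite hp
    (s := Fintype.piFinset fun _ => Finset.Icc (-(n : ℤ)) (n : ℤ)) fun k hk => if_neg ?_
  contrapose! hk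
  rw [Fintype.mem_piFinset]
  intro j
  have : (k j).natAbs ≤ l1 k :=
    Finset.single_le_sum (f := fun j => (k j).natAbs) (fun _ _ => Nat.zero_le _)
      (Finset.mem_univ j)
  rw [Finset.mem_Icc]; omega

/-- A single fixed `δ` suffices: on the shells `ν ≥ r` the factor `1 - (1-δ)^(ν-r+1)` is at least
`δ`, and only finitely many coefficients remain. -/
theorem CoeffPoissonRate.spNorm_lt_top (hr : 1 ≤ r) (hp : 1 ≤ p) (hω : IsMajorant ω)
    (hB : BariCondition ω) {c : TrigSeries d} (h : CoeffPoissonRate p r ω c) :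
    spNorm p (derivSeries (r - 1) c) < ⊤ := by
  obtain ⟨C, hC⟩ := h.deriv_pred hr hp hω hB
  obtain ⟨δ, hδ, hδ0, hδ1⟩ :=
    (hC.and (Ioo_mem_nhdsGT (show (0 : ℝ) < 1 by norm_num))).exists
  have h1 : spNorm p (fun k => if l1 k < r then 0 else derivSeries (r - 1) c k) < ⊤ := by
    refine (spNorm_le_const_mul hp (t := δ⁻¹) (c := fun k =>
      ((1 - (1 - δ) ^ (l1 k - (r - 1)) : ℝ) : ℂ) * derivSeries (r - 1) c k) fun k => ?_).trans_lt
      (ENNReal.mul_lt_top ENNReal.ofReal_lt_top (hδ.trans_lt ENNReal.ofReal_lt_top))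
    have h0 : 0 ≤ 1 - δ := by linarith
    have h2 : (1 - δ) ^ (l1 k - (r - 1)) ≤ 1 := pow_le_one₀ h0 (by linarith)
    rw [norm_mul, Complex.norm_real, Real.norm_of_nonneg (by linarith)]
    split_ifs with hk
    · rw [norm_zero]
      have : 0 ≤ 1 - (1 - δ) ^ (l1 k - (r - 1)) := by linarith
      positivity
    · have h3 : (1 - δ) ^ (l1 k - (r - 1)) ≤ 1 - δ := by
        have := pow_le_pow_of_le_one h0 (by linarith) (show 1 ≤ l1 k - (r - 1) by omega)
        simpa using this
      rw [← mul_assoc]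
      refine le_mul_of_one_le_left (norm_nonneg _) ?_
      rw [inv_mul_eq_div, le_div_iff₀ hδ0]; linarith
  refine (spNorm_le_add hp fun k => ?_).trans_lt
    (ENNReal.add_lt_top.2 ⟨h1, spNorm_truncate_lt_top hp r (derivSeries (r - 1) c)⟩)
  split_ifs <;> simp

/-! ### Increments along the diagonal -/

theorem expo_neg_diag (k : Fin d → ℤ) (h : ℝ) :
    expo k (-diag d h) = Complex.exp (Complex.I * ((-(h * ∑ j, (k j : ℝ)) : ℝ) : ℂ)) := by
  have hterm : ∀ j, fourier (k j) ((-diag d h) j) =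
      Complex.exp (Complex.I * ((-(h * (k j : ℝ)) : ℝ) : ℂ)) := by
    intro j
    have : (-diag d h) j = ((-h : ℝ) : AddCircle (2 * Real.pi)) := by simp [diag]
    rw [this, fourier_coe_apply]
    congr 1
    have hpi : (Real.pi : ℂ) ≠ 0 := by exact_mod_cast Real.pi_ne_zero
    push_cast
    field_simp
  rw [expo, Finset.prod_congr rfl fun j _ => hterm j, ← Complex.exp_sum]
  congr 1
  push_cast
  rw [← Finset.mul_sum, Finset.sum_neg_distrib, Finset.mul_sum]

theorem norm_sub_mul_expo (a : ℂ) (k : Fin d → ℤ) (h : ℝ) :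
    ‖a - a * expo k (-diag d h)‖ = ‖a‖ * (2 * |Real.sin (h * (∑ j, (k j : ℝ)) / 2)|) := by
  rw [← mul_one_sub, norm_mul, norm_sub_rev, expo_neg_diag,
    Complex.norm_exp_I_mul_ofReal_sub_one, norm_mul, Real.norm_eq_abs, Real.norm_eq_abs]
  congr 2
  · norm_num
  · rw [neg_div, Real.sin_neg, abs_neg]

theorem abs_sum_le_l1 (k : Fin d → ℤ) : |∑ j, (k j : ℝ)| ≤ l1 k := by
  refine (Finset.abs_sum_le_sum_abs _ _).trans (le_of_eq ?_)
  simp [l1, Nat.cast_natAbs]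

theorem norm_sub_mul_expo_le (a : ℂ) (k : Fin d → ℤ) {h δ : ℝ} (hh : |h| ≤ δ) :
    ‖a - a * expo k (-diag d h)‖ ≤ ‖a‖ * min 2 (l1 k * δ) := by
  rw [norm_sub_mul_expo]
  refine mul_le_mul_of_nonneg_left (le_min ?_ ?_) (norm_nonneg _)
  · linarith [Real.abs_sin_le_one (h * (∑ j, (k j : ℝ)) / 2)]
  · have h1 := Real.abs_sin_le_abs (x := h * (∑ j, (k j : ℝ)) / 2)
    have h2 : |h * (∑ j, (k j : ℝ)) / 2| = |h| * |∑ j, (k j : ℝ)| / 2 := by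
      rw [abs_div, abs_mul, abs_two]
    have h3 : |h| * |∑ j, (k j : ℝ)| ≤ δ * l1 k :=
      mul_le_mul hh (abs_sum_le_l1 k) (abs_nonneg _) ((abs_nonneg h).trans hh)
    linarith

/-- The proviso `δ = O(ω(δ))` holds automatically if the derivative of order `r` is nonzero. -/
theorem CoeffPoissonRate.isBigO (hp : 1 ≤ p) (hω : IsMajorant ω) {c : TrigSeries d}
    (h : CoeffPoissonRate p r ω c) {k : Fin d → ℤ} (hk : r ≤ l1 k) (hck : c k ≠ 0) :
    (fun δ : ℝ => δ) =O[𝓝[>] (0 : ℝ)] ω := by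
  obtain ⟨C, hC⟩ := h
  have hD : 0 < ‖derivSeries r c k‖ := by
    rw [norm_pos_iff, derivSeries]
    refine mul_ne_zero ?_ hck
    exact_mod_cast (Nat.descFactorial_pos.2 hk).ne'
  -- For `δ < 1/2` the coefficient at `k` of the Poisson mean of the derivative has modulus at least
  -- `A`. One coefficient never exceeds the norm, so `A ≤ |C| ω(δ)/δ`.
  set A : ℝ := (1 / 2) ^ l1 k * ‖derivSeries r c k‖ with hA
  have hA0 : 0 < A := by positivity
  refine IsBigO.of_bound (|C| / A) ?_
  filter_upwards [hC, Ioo_mem_nhdsGT (show (0 : ℝ) < 1 / 2 by norm_num)] with δ hδ hδ1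
  obtain ⟨hδ0, hδ1⟩ := hδ1
  have hωδ := hω.pos hδ0 (by linarith)
  have h1 := ((enorm_le_spNorm hp _ k).trans hδ).trans (ofReal_mul_le_abs (div_pos hωδ hδ0).le)
  rw [← ofReal_norm, norm_descFactorial_mul_pow _ _ (by linarith),
    ENNReal.ofReal_le_ofReal_iff (by positivity)] at h1
  have h2 : A ≤ (1 - δ) ^ l1 k * ‖derivSeries r c k‖ := by
    rw [hA]; gcongr; linarith
  have h3 := h2.trans h1
  rw [Real.norm_of_nonneg hδ0.le, Real.norm_of_nonneg hωδ.le, div_mul_eq_mul_div,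
    le_div_iff₀ hA0]
  rw [mul_div_assoc', le_div_iff₀ hδ0] at h3
  linarith

theorem CoeffPoissonRate.seriesInSpH (hr : 1 ≤ r) (hp : 1 ≤ p) (hω : IsMajorant ω)
    (hB : BariCondition ω) {c : TrigSeries d}
    (hO : 2 ≤ r → (∀ k, r ≤ l1 k → c k = 0) → (fun δ : ℝ => δ) =O[𝓝[>] (0 : ℝ)] ω)
    (h : CoeffPoissonRate p r ω c) : SeriesInSpH p ω (derivSeries (r - 1) c) := by
  refine ⟨h.spNorm_lt_top hr hp hω hB, ?_⟩
  obtain ⟨C, hC⟩ := h.deriv_pred hr hp hω hB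
  set a := derivSeries (r - 1) c
  set S := spNorm p (fun k => if l1 k < r then a k else 0) with hS
  have hStop : S ≠ ⊤ := (spNorm_truncate_lt_top hp r a).ne
  -- This pays for the shells `ν < r`, where the increment is at most `(r-1)δ` times the
  -- coefficient. For `r = 1` only `k = 0` is left, which does not move, so `E = 0` works.
  obtain ⟨E, hE0, hE⟩ : ∃ E : ℝ, 0 ≤ E ∧ ∀ᶠ δ in 𝓝[>] (0 : ℝ), (r - 1) * δ ≤ E * ω δ := by
    rcases Nat.lt_or_ge r 2 with hr2 | hr2
    · obtain rfl : r = 1 := by omega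
      exact ⟨0, le_rfl, by simp⟩
    · have hO' : (fun δ : ℝ => δ) =O[𝓝[>] (0 : ℝ)] ω := by
        by_cases hz : ∀ k, r ≤ l1 k → c k = 0
        · exact hO hr2 hz
        · push Not at hz
          obtain ⟨k, hk, hck⟩ := hz
          exact h.isBigO hp hω hk hck
      obtain ⟨E, hE0, hE⟩ := hO'.exists_pos
      have hr2' : (2 : ℝ) ≤ r := by exact_mod_cast hr2
      have hr0 : (0 : ℝ) ≤ r - 1 := by linarith
      refine ⟨(r - 1) * E, by positivity, ?_⟩
      filter_upwards [hE.bound, Ioo_mem_nhdsGT (show (0 : ℝ) < 1 by norm_num)] with δ hδ hδ1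
      rw [Real.norm_of_nonneg hδ1.1.le, Real.norm_of_nonneg (hω.pos hδ1.1 hδ1.2.le).le] at hδ
      nlinarith
  refine ⟨3 * r * |C| + E * S.toReal, ?_⟩
  filter_upwards [hC, hE, Ioo_mem_nhdsGT (show (0 : ℝ) < 1 by norm_num)] with δ hδ hEδ hδ1
  obtain ⟨hδ0, hδ1⟩ := hδ1
  have hωδ := hω.pos hδ0 hδ1.le
  have hr1 : (1 : ℝ) ≤ r := by exact_mod_cast hr
  refine iSup₂_le fun h hh => ?_
  calc spNorm p (fun k => a k - a k * expo k (-diag d h))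
      ≤ spNorm p (fun k => ((3 * r : ℝ) : ℂ) *
            (((1 - (1 - δ) ^ (l1 k - (r - 1)) : ℝ) : ℂ) * a k)) +
          spNorm p (fun k => (((r - 1) * δ : ℝ) : ℂ) * (if l1 k < r then a k else 0)) := by
        refine spNorm_le_add hp fun k => (norm_sub_mul_expo_le _ _ hh).trans ?_
        have h0 : 0 ≤ 1 - δ := by linarith
        have h2 : (1 - δ) ^ (l1 k - (r - 1)) ≤ 1 := pow_le_one₀ h0 (by linarith)
        have hrδ : 0 ≤ (r - 1) * δ := mul_nonneg (by linarith) hδ0.le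
        rw [norm_mul, norm_mul, norm_mul, Complex.norm_real, Complex.norm_real,
          Complex.norm_real, Real.norm_of_nonneg (by positivity),
          Real.norm_of_nonneg (by linarith), Real.norm_of_nonneg hrδ]
        split_ifs with hk
        · rw [mul_comm]
          have h3 : min 2 (l1 k * δ) ≤ (r - 1) * δ := by
            refine (min_le_right _ _).trans (mul_le_mul_of_nonneg_right ?_ hδ0.le)
            have : (l1 k : ℝ) + 1 ≤ r := by exact_mod_cast hk
            linarith
          refine (mul_le_mul_of_nonneg_right h3 (norm_nonneg _)).trans ?_
          have : 0 ≤ 3 * (r : ℝ) * ((1 - (1 - δ) ^ (l1 k - (r - 1))) * ‖a k‖) :=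
            mul_nonneg (by positivity) (mul_nonneg (by linarith) (norm_nonneg _))
          linarith
        · rw [norm_zero, mul_zero, add_zero, mul_comm, ← mul_assoc]
          refine mul_le_mul_of_nonneg_right ?_ (norm_nonneg _)
          have h4 := min_le_one_sub_pow (l1 k - (r - 1)) hδ0 hδ1.le
          -- For `ν = r + n` this reads `r + n ≤ r(n + 1)`. Together with the `3` of
          -- `min_le_one_sub_pow` it produces the constant `3r`.
          have h5 : (l1 k : ℝ) ≤ r * ((l1 k - (r - 1) : ℕ) : ℝ) := by
            have : l1 k ≤ r * (l1 k - (r - 1)) := by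
              obtain ⟨n, hn⟩ := Nat.exists_eq_add_of_le (not_lt.1 hk)
              obtain ⟨q, rfl⟩ := Nat.exists_eq_add_of_le' hr
              rw [hn, show q + 1 + n - (q + 1 - 1) = n + 1 by omega]
              nlinarith
            exact_mod_cast this
          have h6 : min 2 (l1 k * δ) ≤ r * min 2 (((l1 k - (r - 1) : ℕ) : ℝ) * δ) := by
            rw [mul_min_of_nonneg _ _ (by linarith : (0 : ℝ) ≤ r)]
            refine min_le_min (by linarith) ?_
            nlinarith
          nlinarith
    _ ≤ ENNReal.ofReal (3 * r) * ENNReal.ofReal (|C| * ω δ) +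
          ENNReal.ofReal ((r - 1) * δ) * S := by
        refine add_le_add ?_ ?_
        · refine (spNorm_le_const_mul hp fun k => le_of_eq ?_).trans
            (mul_le_mul_right (hδ.trans (ofReal_mul_le_abs hωδ.le)) _)
          rw [norm_mul, Complex.norm_real, Real.norm_of_nonneg (by positivity)]
        · refine spNorm_le_const_mul hp fun k => le_of_eq ?_
          rw [norm_mul, Complex.norm_real,
            Real.norm_of_nonneg (mul_nonneg (by linarith) hδ0.le)]
    _ ≤ ENNReal.ofReal (3 * r) * ENNReal.ofReal (|C| * ω δ) +
          ENNReal.ofReal (E * ω δ) * ENNReal.ofReal S.toReal := by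
        rw [ENNReal.ofReal_toReal hStop]
        gcongr
    _ = _ := by
        rw [← ENNReal.ofReal_mul (by positivity), ← ENNReal.ofReal_mul (by positivity),
          ← ENNReal.ofReal_add (by positivity) (by positivity)]
        congr 1; ring

/-- Coordinates of one sign do not cancel. This is what the spectral condition is for: diagonal
shifts then see the full degree `|k|₁`. -/
theorem abs_sum_eq_l1 {k : Fin d → ℤ} (hk : (∀ j, 0 ≤ k j) ∨ ∀ j, k j < 0) :
    |∑ j, (k j : ℝ)| = l1 k := by
  have h1 : ((l1 k : ℕ) : ℝ) = ∑ j, |(k j : ℝ)| := by simp [l1, Nat.cast_natAbs]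
  rw [h1]
  rcases hk with hk | hk
  · have h2 : ∀ j, (0 : ℝ) ≤ k j := fun j => by exact_mod_cast hk j
    rw [abs_of_nonneg (Finset.sum_nonneg fun j _ => h2 j)]
    exact Finset.sum_congr rfl fun j _ => (abs_of_nonneg (h2 j)).symm
  · have h2 : ∀ j, (k j : ℝ) ≤ 0 := fun j => by exact_mod_cast (hk j).le
    rw [abs_of_nonpos (Finset.sum_nonpos fun j _ => h2 j), ← Finset.sum_neg_distrib]
    exact Finset.sum_congr rfl fun j _ => (abs_of_nonpos (h2 j)).symm

/-- Halve `δ` until `y = δν/2^j` is at most `2`; then still `y ≥ min(1, δν)`, which bounds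
`δν(1-δ)^ν`. As `y/2 ≤ 1` lies in the range of Jordan's inequality, `sin(y/2) ≥ y/4`. -/
theorem exists_mul_one_sub_pow_le_sin {x : ℝ} {δ : ℝ} {ν : ℕ} (hδ : 0 < δ) (hδ1 : δ ≤ 1) (hx : |x| = ν) :
    ∃ j : ℕ, ν * (1 - δ) ^ ν ≤ δ⁻¹ * (2 * (2 * |Real.sin (δ / 2 ^ j * x / 2)|)) := by
  have hν : (0 : ℝ) ≤ ν := Nat.cast_nonneg ν
  have h0 : 0 ≤ 1 - δ := by linarith
  obtain ⟨j, hj, hlow⟩ : ∃ j : ℕ, δ / 2 ^ j * ν ≤ 2 ∧ min 1 (δ * ν) ≤ δ / 2 ^ j * ν := by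
    rcases le_total (δ * ν) 2 with h | h
    · exact ⟨0, by simpa using h, by simp⟩
    · obtain ⟨n, hn1, hn2⟩ := exists_nat_pow_near (show 1 ≤ δ * ν by linarith)
        (show (1 : ℝ) < 2 by norm_num)
      refine ⟨n, ?_, (min_le_left _ _).trans ?_⟩
      · rw [div_mul_eq_mul_div, div_le_iff₀ (by positivity)]
        rw [pow_succ] at hn2; linarith
      · rw [div_mul_eq_mul_div, le_div_iff₀ (by positivity)]; linarith
  refine ⟨j, ?_⟩
  set y := δ / 2 ^ j * ν with hy
  have hy0 : 0 ≤ y := by positivity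
  have hsin : |Real.sin (δ / 2 ^ j * x / 2)| = Real.sin (y / 2) := by
    have hy2 : y / 2 ≤ Real.pi := by linarith [Real.pi_gt_three]
    have habs : |δ / 2 ^ j * x / 2| = y / 2 := by
      rw [abs_div, abs_mul, hx, abs_of_pos (by positivity : 0 < δ / 2 ^ j), abs_two]
    rw [← abs_of_nonneg (Real.sin_nonneg_of_nonneg_of_le_pi (by linarith) hy2), ← habs]
    rcases abs_cases (δ / 2 ^ j * x / 2) with ⟨h, _⟩ | ⟨h, _⟩
    · rw [h]
    · rw [h, Real.sin_neg, abs_neg]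
  have hs : y / 4 ≤ Real.sin (y / 2) := by
    have h1 := Real.mul_le_sin (x := y / 2) (by linarith) (by linarith [Real.pi_gt_three])
    have h2 : (1 : ℝ) / 2 ≤ 2 / Real.pi := by
      rw [div_le_div_iff₀ (by norm_num) Real.pi_pos]; linarith [Real.pi_le_four]
    nlinarith
  rw [hsin]
  have hmin : ν * (1 - δ) ^ ν * δ ≤ min 1 (δ * ν) := by
    refine le_min ?_ ?_
    · have h1 := one_sub_pow_mul_le_one ν hδ hδ1
      have h2 : 0 ≤ (1 - δ) ^ ν := by positivity
      nlinarith
    · have h2 : (1 - δ) ^ ν ≤ 1 := pow_le_one₀ h0 (by linarith)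
      have h3 : 0 ≤ δ * ν := by positivity
      nlinarith
  rw [inv_mul_eq_div, le_div_iff₀ hδ]
  linarith

/-- The useful scale `j` depends on `k`. Replacing it by the sum over all `j` removes this
dependence, and the dyadic Bari condition keeps the sum of order `ω(δ)`. -/
theorem coeffPoissonRate_of_seriesInSpH (hr : 1 ≤ r) (hp : 1 ≤ p) (hω : IsMajorant ω)
    (hB : BariCondition ω) {c : TrigSeries d}
    (hY : ∀ k : Fin d → ℤ, ¬ ((∀ j, 0 ≤ k j) ∨ ∀ j, k j < 0) → c k = 0)
    (h : SeriesInSpH p ω (derivSeries (r - 1) c)) : CoeffPoissonRate p r ω c := by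
  obtain ⟨-, C, hC⟩ := h
  obtain ⟨D, hD0, hD⟩ := hB.dyadic hω
  refine ⟨2 * |C| * D, ?_⟩
  filter_upwards [eventually_forall_le hC, hD, Ioo_mem_nhdsGT (show (0 : ℝ) < 1 by norm_num)]
    with δ hδ hDδ hδ1
  obtain ⟨hδ0, hδ1⟩ := hδ1
  set a := derivSeries (r - 1) c with ha
  have hωδ := hω.pos hδ0 hδ1.le
  have hpos : ∀ j : ℕ, 0 < δ / 2 ^ j := fun j => by positivity
  have hle : ∀ j : ℕ, δ / 2 ^ j ≤ δ := fun j => div_le_self hδ0.le (one_le_pow₀ (by norm_num))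
  refine (spNorm_le_tsum hp (t := fun _ => 2 * δ⁻¹)
    (b := fun j k => a k - a k * expo k (-diag d (δ / 2 ^ j))) fun k => ?_).trans ?_
  · by_cases hk : (∀ j, 0 ≤ k j) ∨ ∀ j, k j < 0
    · obtain ⟨j, hj⟩ := exists_mul_one_sub_pow_le_sin hδ0 hδ1.le (abs_sum_eq_l1 hk)
      refine le_trans ?_ (ENNReal.le_tsum j)
      rw [← ofReal_norm, ← ofReal_norm, ← ENNReal.ofReal_mul (by positivity),
        norm_descFactorial_mul_pow _ _ hδ1.le, norm_sub_mul_expo, derivSeries_eq hr, norm_mul,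
        Complex.norm_natCast]
      refine ENNReal.ofReal_le_ofReal ?_
      have h0 : 0 ≤ 1 - δ := by linarith
      have h1 : ((l1 k - (r - 1) : ℕ) : ℝ) ≤ l1 k := by exact_mod_cast Nat.sub_le _ _
      calc (1 - δ) ^ l1 k * (((l1 k - (r - 1) : ℕ) : ℝ) * ‖a k‖)
          ≤ (1 - δ) ^ l1 k * (l1 k * ‖a k‖) := by gcongr
        _ = (l1 k * (1 - δ) ^ l1 k) * ‖a k‖ := by ring
        _ ≤ _ := mul_le_mul_of_nonneg_right hj (norm_nonneg _)
        _ = _ := by ring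
    · simp [hY k hk]
  · rw [ENNReal.tsum_mul_left]
    calc ENNReal.ofReal (2 * δ⁻¹) * ∑' j : ℕ, spNorm p
          (fun k => a k - a k * expo k (-diag d (δ / 2 ^ j)))
        ≤ ENNReal.ofReal (2 * δ⁻¹) * ∑' j : ℕ, ENNReal.ofReal |C| *
            ENNReal.ofReal (ω (δ / 2 ^ j)) := by
          refine mul_le_mul_right (ENNReal.tsum_le_tsum fun j => ?_) _
          rw [← ENNReal.ofReal_mul (abs_nonneg C)]
          refine le_trans ?_ ((hδ _ (hpos j) (hle j)).trans
            (ofReal_mul_le_abs (hω.pos (hpos j) ((hle j).trans hδ1.le)).le))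
          exact le_iSup₂_of_le (f := fun h (_ : |h| ≤ δ / 2 ^ j) =>
            spNorm p fun k => a k - a k * expo k (-diag d h)) _ (abs_of_pos (hpos j)).le le_rfl
      _ ≤ ENNReal.ofReal (2 * δ⁻¹) * (ENNReal.ofReal |C| * ENNReal.ofReal (D * ω δ)) := by
          rw [ENNReal.tsum_mul_left]; gcongr
      _ = _ := by
          rw [← ENNReal.ofReal_mul (abs_nonneg C), ← ENNReal.ofReal_mul (by positivity)]
          congr 1; field_simp

end rates

/-! ### Exponentials on the torus -/

section expo
variable {d : ℕ}

theorem integral_fourier (n : ℤ) :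
    ∫ x : AddCircle (2 * Real.pi), fourier n x = if n = 0 then ((2 * Real.pi : ℝ) : ℂ) else 0 := by
  have h := fourierCoeff_fourier (T := 2 * Real.pi) n
  have h0 := congrFun h 0
  rw [fourierCoeff, AddCircle.integral_haarAddCircle] at h0
  simp only [neg_zero, fourier_zero, one_smul] at h0
  rw [inv_smul_eq_iff₀ Real.two_pi_pos.ne'] at h0
  rw [h0]
  rcases eq_or_ne n 0 with rfl | hn
  · simp
  · simp [hn, Ne.symm hn]

theorem integral_expo (k : Fin d → ℤ) :
    ∫ x, expo k x = if k = 0 then ((2 * Real.pi : ℝ) : ℂ) ^ d else 0 := by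
  unfold expo
  rw [integral_fintype_prod_volume_eq_prod (fun j => (fourier (k j) : AddCircle (2 * Real.pi) → ℂ))]
  simp_rw [integral_fourier]
  split_ifs with h
  · simp [h]
  · obtain ⟨j, hj⟩ := Function.ne_iff.1 h
    exact Finset.prod_eq_zero (Finset.mem_univ j) (if_neg hj)

theorem continuous_expo (k : Fin d → ℤ) : Continuous (expo k) :=
  continuous_finsetProd _ fun j _ => (fourier (k j)).continuous.comp (continuous_apply j)

theorem norm_expo (k : Fin d → ℤ) (x : Torus d) : ‖expo k x‖ = 1 := by
  simp [expo, norm_prod, fourier_apply, Circle.norm_coe]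

theorem expo_add (k l : Fin d → ℤ) (x : Torus d) : expo (k + l) x = expo k x * expo l x := by
  simp [expo, ← Finset.prod_mul_distrib]

theorem expo_add_right (k : Fin d → ℤ) (x y : Torus d) :
    expo k (x + y) = expo k x * expo k y := by
  simp [expo, ← Finset.prod_mul_distrib, fourier_apply, smul_add, AddCircle.toCircle_add]

theorem expo_neg (k : Fin d → ℤ) (x : Torus d) : expo (-k) x = expo k (-x) := by
  simp [expo, fourier_apply]

theorem expo_neg_eq_conj (k : Fin d → ℤ) (x : Torus d) :
    expo (-k) x = starRingEnd ℂ (expo k x) := by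
  simp only [expo, Pi.neg_apply, map_prod, fourier_neg]

end expo

/-! ### Fourier series of the means and of translates -/

section fourierSeries
variable {d : ℕ}

theorem integrable_mul_expo {f : Torus d → ℂ} (hf : Integrable f) (k : Fin d → ℤ) :
    Integrable fun x => f x * expo k x :=
  hf.mul_bdd (c := 1) (continuous_expo k).aestronglyMeasurable
    (Eventually.of_forall fun x => (norm_expo k x).le)

theorem fourierSeries_sub {f g : Torus d → ℂ} (hf : Integrable f) (hg : Integrable g) :
    fourierSeries (fun x => f x - g x) = fun k => fourierSeries f k - fourierSeries g k := by
  funext k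
  simp only [fourierSeries, sub_mul]
  rw [integral_sub (integrable_mul_expo hf _) (integrable_mul_expo hg _), mul_sub]

theorem norm_fourierSeries_le (f : Torus d → ℂ) (k : Fin d → ℤ) :
    ‖fourierSeries f k‖ ≤ ‖((2 * Real.pi : ℝ) : ℂ)⁻¹ ^ d‖ * ∫ x, ‖f x‖ := by
  rw [fourierSeries, norm_mul]
  refine mul_le_mul_of_nonneg_left ?_ (norm_nonneg _)
  refine (norm_integral_le_integral_norm _).trans (le_of_eq ?_)
  simp [norm_expo]

theorem fourierSeries_translate {g : Torus d → ℂ} (hg : Integrable g) (a : Torus d) :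
    fourierSeries (fun x => g x - g (x - a)) =
      fun k => fourierSeries g k - fourierSeries g k * expo k (-a) := by
  rw [fourierSeries_sub hg (hg.comp_sub_right a)]
  funext k
  congr 1
  simp only [fourierSeries]
  rw [← integral_add_right_eq_self _ a]
  simp only [add_sub_cancel_right, expo_add_right (-k), ← mul_assoc]
  rw [integral_mul_const, expo_neg k a, mul_assoc]

theorem two_pi_pow_ne_zero : ((2 * Real.pi : ℝ) : ℂ) ^ d ≠ 0 :=
  pow_ne_zero _ (by exact_mod_cast Real.two_pi_pos.ne')

theorem continuous_tsum_expo {b : TrigSeries d} (hb : Summable fun k => ‖b k‖) :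
    Continuous fun x : Torus d => ∑' k, b k * expo k x :=
  continuous_tsum (fun k => continuous_const.mul (continuous_expo k)) hb
    fun k x => by rw [norm_mul, norm_expo, mul_one]

theorem fourierSeries_tsum_expo {b : TrigSeries d} (hb : Summable fun k => ‖b k‖) :
    fourierSeries (fun x : Torus d => ∑' k, b k * expo k x) = b := by
  funext l
  have hint : ∀ k, Integrable fun x : Torus d => b k * expo k x * expo (-l) x := fun k =>
    Continuous.integrable_of_hasCompactSupport
      ((continuous_const.mul (continuous_expo k)).mul (continuous_expo (-l)))
      (HasCompactSupport.of_compactSpace _)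
  have hsum : Summable fun k => ∫ x : Torus d, ‖b k * expo k x * expo (-l) x‖ := by
    simp only [norm_mul, norm_expo, mul_one, integral_const, smul_eq_mul]
    exact hb.mul_left _
  have h := hasSum_integral_of_summable_integral_norm hint hsum
  have hterm : ∀ k, ∫ x : Torus d, b k * expo k x * expo (-l) x =
      if k = l then b k * ((2 * Real.pi : ℝ) : ℂ) ^ d else 0 := by
    intro k
    simp_rw [mul_assoc, ← expo_add]
    rw [integral_const_mul, integral_expo]
    simp [← sub_eq_add_neg, sub_eq_zero]
  simp_rw [hterm] at h
  have h' := h.unique (hasSum_single l fun k hk => if_neg hk)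
  rw [if_pos rfl] at h'
  simp only [fourierSeries, ← tsum_mul_right]
  rw [h', inv_pow, mul_comm, mul_assoc, mul_inv_cancel₀ two_pi_pow_ne_zero, mul_one]

theorem mem_shell {ν : ℕ} {k : Fin d → ℤ} : k ∈ shell d ν ↔ l1 k = ν := by
  rw [shell, Finset.mem_filter, and_iff_right_iff_imp]
  intro h
  rw [Fintype.mem_piFinset]
  intro j
  have : (k j).natAbs ≤ l1 k :=
    Finset.single_le_sum (f := fun j => (k j).natAbs) (fun _ _ => Nat.zero_le _)
      (Finset.mem_univ j)
  rw [Finset.mem_Icc]; omega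

theorem hasSum_block {b : TrigSeries d} (hb : Summable fun k => ‖b k‖) (x : Torus d) :
    HasSum (fun ν => block b ν x) (∑' k, b k * expo k x) := by
  have hs : Summable fun k => b k * expo k x :=
    Summable.of_norm (by simpa only [norm_mul, norm_expo, mul_one] using hb)
  have h := hs.hasSum.tsum_fiberwise l1
  have hfib : ∀ ν, block b ν x = ∑' k : (l1 ⁻¹' {ν} : Set (Fin d → ℤ)), b k * expo k x := by
    intro ν
    have : l1 ⁻¹' {ν} = {k : Fin d → ℤ | k ∈ shell d ν} := by
      ext k; simp [mem_shell]
    rw [this, block, ← Finset.tsum_subtype]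
    rfl
  rw [funext hfib]
  exact h

theorem card_shell_le (ν : ℕ) : (shell d ν).card ≤ (2 * ν + 1) ^ d := by
  refine (Finset.card_filter_le _ _).trans ?_
  rw [Fintype.card_piFinset]
  simp only [Int.card_Icc, Finset.prod_const, Finset.card_univ, Fintype.card_fin]
  refine Nat.pow_le_pow_left ?_ d
  omega

theorem summable_comp_l1 {w : ℕ → ℝ} (h0 : ∀ ν, 0 ≤ w ν)
    (hw : Summable fun ν : ℕ => (2 * ν + 1 : ℝ) ^ d * w ν) :
    Summable fun k : Fin d → ℤ => w (l1 k) := by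
  classical
  refine summable_of_sum_le (fun k => h0 _) (c := ∑' ν : ℕ, (2 * ν + 1 : ℝ) ^ d * w ν) fun u => ?_
  rw [Finset.sum_comp w l1]
  refine le_trans (Finset.sum_le_sum fun ν _ => ?_)
    (hw.sum_le_tsum _ fun ν _ => mul_nonneg (by positivity) (h0 ν))
  rw [nsmul_eq_mul]
  refine mul_le_mul_of_nonneg_right ?_ (h0 ν)
  have h1 : (u.filter fun k => l1 k = ν).card ≤ (shell d ν).card :=
    Finset.card_le_card fun k hk => mem_shell.2 (Finset.mem_filter.1 hk).2
  exact_mod_cast h1.trans (card_shell_le ν)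

/-- A shell holds at most `(2ν+1)^d` indices, so polynomial growth times `ρ^ν` stays summable. Since
Fourier coefficients are bounded, this makes the means absolutely convergent for each `ρ < 1`. -/
theorem summable_norm_of_le {b : TrigSeries d} {ρ A : ℝ} (h0 : 0 < ρ) (h1 : ρ < 1) (M : ℕ)
    (h : ∀ k, ‖b k‖ ≤ A * ((l1 k + 1 : ℝ) ^ M * ρ ^ l1 k)) : Summable fun k => ‖b k‖ := by
  refine Summable.of_nonneg_of_le (fun k => norm_nonneg _) h (Summable.mul_left _ ?_)
  refine summable_comp_l1 (w := fun ν : ℕ => (ν + 1 : ℝ) ^ M * ρ ^ ν) (fun ν => by positivity) ?_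
  have hs := summable_pow_mul_geometric_of_norm_lt_one (R := ℝ) (d + M) (r := ρ)
    (by rwa [Real.norm_of_nonneg h0.le])
  have hs' := ((summable_nat_add_iff 1).2 hs).mul_left (2 ^ d * ρ⁻¹)
  refine Summable.of_nonneg_of_le (fun ν => by positivity) (fun ν => ?_) hs'
  have h2 : (2 * ν + 1 : ℝ) ^ d ≤ (2 * (ν + 1)) ^ d := by gcongr; linarith
  calc (2 * ν + 1 : ℝ) ^ d * ((ν + 1 : ℝ) ^ M * ρ ^ ν)
      ≤ (2 * (ν + 1)) ^ d * ((ν + 1 : ℝ) ^ M * ρ ^ ν) := by gcongr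
    _ = _ := by
      push_cast
      rw [mul_pow, pow_add _ d M, pow_succ]
      field_simp

theorem tapCoeff_le {r ν : ℕ} {ρ : ℝ} (h0 : 0 < ρ) (h1 : ρ < 1) :
    tapCoeff r ν ρ ≤ r * (ρ ^ r)⁻¹ * ((ν + 1 : ℝ) ^ r * ρ ^ ν) := by
  have hterm : ∀ k ∈ Finset.range r, (ν.choose k : ℝ) * (1 - ρ) ^ k * ρ ^ (ν - k) ≤
      (ρ ^ r)⁻¹ * ((ν + 1 : ℝ) ^ r * ρ ^ ν) := by
    intro k hk
    rw [Finset.mem_range] at hk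
    have h2 : (ν.choose k : ℝ) ≤ (ν + 1 : ℝ) ^ r := by
      have : ν.choose k ≤ (ν + 1) ^ r :=
        (Nat.choose_le_pow ν k).trans ((Nat.pow_le_pow_left (Nat.le_succ ν) k).trans
          (Nat.pow_le_pow_right (Nat.succ_pos ν) hk.le))
      exact_mod_cast this
    have h3 : (1 - ρ) ^ k ≤ 1 := pow_le_one₀ (by linarith) (by linarith)
    have h4 : ρ ^ (ν - k) ≤ (ρ ^ r)⁻¹ * ρ ^ ν := by
      rw [inv_mul_eq_div, le_div_iff₀ (by positivity), ← pow_add]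
      exact pow_le_pow_of_le_one h0.le h1.le (by omega)
    have h5 : 0 ≤ (1 - ρ) ^ k := pow_nonneg (by linarith) k
    calc (ν.choose k : ℝ) * (1 - ρ) ^ k * ρ ^ (ν - k)
        ≤ (ν + 1 : ℝ) ^ r * 1 * ((ρ ^ r)⁻¹ * ρ ^ ν) := by gcongr
      _ = _ := by ring
  refine (Finset.sum_le_card_nsmul _ _ _ hterm).trans (le_of_eq ?_)
  rw [Finset.card_range, nsmul_eq_mul, mul_assoc]

theorem block_mul (w : ℕ → ℂ) (c : TrigSeries d) (ν : ℕ) (x : Torus d) :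
    block (fun k => w (l1 k) * c k) ν x = w ν * block c ν x := by
  unfold block
  rw [Finset.mul_sum]
  refine Finset.sum_congr rfl fun k hk => ?_
  beta_reduce
  rw [mem_shell.1 hk, mul_assoc]

theorem summable_tapCoeff_mul (f : Torus d → ℂ) (r : ℕ) {ρ : ℝ} (h0 : 0 < ρ) (h1 : ρ < 1) :
    Summable fun k : Fin d → ℤ => ‖(tapCoeff r (l1 k) ρ : ℂ) * fourierSeries f k‖ := by
  set B := ‖((2 * Real.pi : ℝ) : ℂ)⁻¹ ^ d‖ * ∫ x, ‖f x‖
  refine summable_norm_of_le h0 h1 r (A := r * (ρ ^ r)⁻¹ * B) fun k => ?_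
  have h2 := tapCoeff_nonneg r (l1 k) h0.le h1.le
  rw [norm_mul, Complex.norm_real, Real.norm_of_nonneg h2]
  calc tapCoeff r (l1 k) ρ * ‖fourierSeries f k‖
      ≤ (r * (ρ ^ r)⁻¹ * ((l1 k + 1 : ℝ) ^ r * ρ ^ l1 k)) * B :=
        mul_le_mul (tapCoeff_le h0 h1) (norm_fourierSeries_le f k) (norm_nonneg _) (by positivity)
    _ = _ := by ring

/-- Both pieces of the mean merge into one absolutely convergent multiplier series, because the
multiplier equals `1` below degree `r`. -/
theorem tapMean_eq (f : Torus d → ℂ) (r : ℕ) {ρ : ℝ} (h0 : 0 < ρ) (h1 : ρ < 1) :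
    tapMean r ρ f = fun x => ∑' k, (tapCoeff r (l1 k) ρ : ℂ) * fourierSeries f k * expo k x := by
  funext x
  have h := hasSum_block (summable_tapCoeff_mul f r h0 h1) x
  rw [← h.tsum_eq, ← h.summable.sum_add_tsum_nat_add r, tapMean, partialSum]
  congr 1
  · refine Finset.sum_congr rfl fun ν hν => ?_
    rw [block_mul fun ν => (tapCoeff r ν ρ : ℂ), tapCoeff_of_lt (Finset.mem_range.1 hν)]
    simp
  · exact tsum_congr fun m => (block_mul (fun ν => (tapCoeff r ν ρ : ℂ)) _ _ _).symm

theorem integrable_of_continuous {F : Torus d → ℂ} (hF : Continuous F) : Integrable F :=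
  hF.integrable_of_hasCompactSupport (HasCompactSupport.of_compactSpace _)

theorem fourierSeries_sub_tapMean {f : Torus d → ℂ} (hf : Integrable f) (r : ℕ) {ρ : ℝ}
    (h0 : 0 < ρ) (h1 : ρ < 1) :
    fourierSeries (fun x => f x - tapMean r ρ f x) =
      fun k => ((1 - tapCoeff r (l1 k) ρ : ℝ) : ℂ) * fourierSeries f k := by
  have hs := summable_tapCoeff_mul f r h0 h1
  rw [tapMean_eq f r h0 h1, fourierSeries_sub hf (integrable_of_continuous
    (continuous_tsum_expo hs)), fourierSeries_tsum_expo hs]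
  funext k
  push_cast; ring

theorem fourierSeries_poissonSeries_radialDeriv (f : Torus d → ℂ) (r : ℕ) {ρ : ℝ}
    (h0 : 0 < ρ) (h1 : ρ < 1) :
    fourierSeries (poissonSeries (radialDeriv r f) ρ) =
      fun k => (((l1 k).descFactorial r * ρ ^ l1 k : ℝ) : ℂ) * fourierSeries f k := by
  set B := ‖((2 * Real.pi : ℝ) : ℂ)⁻¹ ^ d‖ * ∫ x, ‖f x‖
  have hs : Summable fun k : Fin d → ℤ =>
      ‖(((l1 k).descFactorial r * ρ ^ l1 k : ℝ) : ℂ) * fourierSeries f k‖ := by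
    refine summable_norm_of_le h0 h1 r (A := B) fun k => ?_
    rw [norm_mul, Complex.norm_real, Real.norm_of_nonneg (by positivity), mul_comm]
    refine mul_le_mul (norm_fourierSeries_le f k) ?_ (by positivity)
      (mul_nonneg (norm_nonneg _) (integral_nonneg fun x => norm_nonneg _))
    have : (l1 k).descFactorial r ≤ (l1 k + 1) ^ r :=
      (Nat.descFactorial_le_pow _ _).trans (Nat.pow_le_pow_left (Nat.le_succ _) r)
    gcongr
    exact_mod_cast this
  conv_rhs => rw [← fourierSeries_tsum_expo hs]
  congr 1
  funext x
  rw [← (hasSum_block hs x).tsum_eq, poissonSeries]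
  refine tsum_congr fun ν => ?_
  rw [← block_mul fun ν => ((ρ ^ ν : ℝ) : ℂ), radialDeriv_eq]
  congr 1
  funext k
  simp only [derivSeries]
  push_cast; ring

theorem eventually_zero_lt_lt_one : ∀ᶠ ρ in 𝓝[<] (1 : ℝ), 0 < ρ ∧ ρ < 1 :=
  Ioo_mem_nhdsLT one_pos

theorem approxRate_iff {p : ℝ} {r : ℕ} {ω : ℝ → ℝ} {f : Torus d → ℂ} (hf : Integrable f) :
    ApproxRate p r ω f ↔ CoeffApproxRate p r ω (fourierSeries f) := by
  unfold ApproxRate SpBigO CoeffApproxRate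
  refine exists_congr fun C => ?_
  rw [← eventually_congr (eventually_zero_lt_lt_one.mono fun ρ hρ => by
    rw [fourierSeries_sub_tapMean hf r hρ.1 hρ.2]), eventually_nhdsLT_one_iff]
  simp only [sub_sub_cancel]

theorem poissonRate_iff {p : ℝ} {r : ℕ} {ω : ℝ → ℝ} {f : Torus d → ℂ} :
    PoissonRate p r ω f ↔ CoeffPoissonRate p r ω (fourierSeries f) := by
  unfold PoissonRate SpBigO CoeffPoissonRate
  refine exists_congr fun C => ?_
  rw [← eventually_congr (eventually_zero_lt_lt_one.mono fun ρ hρ => by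
    rw [fourierSeries_poissonSeries_radialDeriv f r hρ.1 hρ.2]), eventually_nhdsLT_one_iff]
  simp only [sub_sub_cancel]

end fourierSeries

/-! ### The Poisson integral of a function -/

section poisson
variable {d : ℕ}

/-- With `z = ρe^{it}` the two halves are geometric, and `1/(1-z) + z̄/(1-z̄) = (1-|z|²)/|1-z|²`. -/
theorem hasSum_poissonKernel_one {ρ : ℝ} (h0 : 0 ≤ ρ) (h1 : ρ < 1)
    (t : AddCircle (2 * Real.pi)) :
    HasSum (fun n : ℤ => ((ρ ^ n.natAbs : ℝ) : ℂ) * fourier n t)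
      (((1 - ρ ^ 2) / (1 - 2 * ρ * Real.Angle.cos t + ρ ^ 2) : ℝ) : ℂ) := by
  set e : ℂ := fourier 1 t with he
  have hen : ‖e‖ = 1 := by simp [he, fourier_apply, Circle.norm_coe]
  have hre : e.re = Real.Angle.cos t := by
    rw [he]
    induction t using QuotientAddGroup.induction_on with
    | H x =>
      have h3 : fourier 1 (x : AddCircle (2 * Real.pi)) = Complex.exp (x * Complex.I) := by
        rw [fourier_coe_apply]
        congr 1
        have hpi : (Real.pi : ℂ) ≠ 0 := by exact_mod_cast Real.pi_ne_zero
        push_cast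
        field_simp
      change (fourier 1 (x : AddCircle (2 * Real.pi))).re = Real.Angle.cos (x : Real.Angle)
      rw [h3, Complex.exp_ofReal_mul_I_re, Real.Angle.cos_coe]
  have hpow : ∀ n : ℕ, fourier (n : ℤ) t = e ^ n := by
    intro n
    simp [he, fourier_apply, AddCircle.toCircle_nsmul]
  set z : ℂ := ρ * e with hz
  have hzn : ‖z‖ < 1 := by
    rw [hz, norm_mul, hen, Complex.norm_real, Real.norm_of_nonneg h0, mul_one]; exact h1
  have hcz : ‖starRingEnd ℂ z‖ < 1 := by rwa [Complex.norm_conj]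
  have hpos := hasSum_geometric_of_norm_lt_one hzn
  have hneg := (hasSum_geometric_of_norm_lt_one hcz).mul_left (starRingEnd ℂ z)
  have h := HasSum.of_nat_of_neg_add_one
    (f := fun n : ℤ => ((ρ ^ n.natAbs : ℝ) : ℂ) * fourier n t)
    (m := (1 - z)⁻¹) (m' := starRingEnd ℂ z * (1 - starRingEnd ℂ z)⁻¹) ?_ ?_
  · convert h using 1
    have hz1 : 1 - z ≠ 0 := fun h => by
      rw [sub_eq_zero] at h; rw [← h] at hzn; simp at hzn
    have hz2 : 1 - starRingEnd ℂ z ≠ 0 := fun h => by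
      rw [sub_eq_zero] at h; rw [← h] at hcz; simp at hcz
    have hmul : z * starRingEnd ℂ z = ((ρ ^ 2 : ℝ) : ℂ) := by
      rw [Complex.mul_conj, Complex.normSq_eq_norm_sq, hz, norm_mul, hen, Complex.norm_real]
      simp
    have hadd : z + starRingEnd ℂ z = ((2 * ρ * Real.Angle.cos t : ℝ) : ℂ) := by
      rw [Complex.add_conj, hz, Complex.re_ofReal_mul, hre, mul_assoc]
    have hden : (1 - z) * (1 - starRingEnd ℂ z) =
        ((1 - 2 * ρ * Real.Angle.cos t + ρ ^ 2 : ℝ) : ℂ) := by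
      rw [Complex.ofReal_add, Complex.ofReal_sub, ← hmul, ← hadd]
      push_cast; ring
    rw [Complex.ofReal_div, ← hden, Complex.ofReal_sub, ← hmul]
    field_simp
    push_cast; ring
  · have hterm : ∀ n : ℕ, ((ρ ^ (n : ℤ).natAbs : ℝ) : ℂ) * fourier (n : ℤ) t = z ^ n := by
      intro n
      rw [hpow, hz, mul_pow, Int.natAbs_natCast, Complex.ofReal_pow]
    simpa only [hterm] using hpos
  · have hterm : ∀ n : ℕ, ((ρ ^ (-((n : ℤ) + 1)).natAbs : ℝ) : ℂ) * fourier (-((n : ℤ) + 1)) t =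
        starRingEnd ℂ z * starRingEnd ℂ z ^ n := by
      intro n
      rw [show (-((n : ℤ) + 1)) = -((n + 1 : ℕ) : ℤ) by push_cast; ring, fourier_neg, hpow,
        ← pow_succ', hz, map_mul, mul_pow, Int.natAbs_neg, Int.natAbs_natCast,
        Complex.ofReal_pow, Complex.conj_ofReal, map_pow (starRingEnd ℂ)]
    simpa only [hterm] using hneg

theorem integral_poissonKernel_one {ρ : ℝ} (h0 : 0 ≤ ρ) (h1 : ρ < 1) (n : ℤ) :
    ∫ t : AddCircle (2 * Real.pi),
        (((1 - ρ ^ 2) / (1 - 2 * ρ * Real.Angle.cos t + ρ ^ 2) : ℝ) : ℂ) * fourier n t =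
      ((ρ ^ n.natAbs : ℝ) : ℂ) * ((2 * Real.pi : ℝ) : ℂ) := by
  have hint : ∀ m : ℤ, Integrable fun t : AddCircle (2 * Real.pi) =>
      ((ρ ^ m.natAbs : ℝ) : ℂ) * fourier m t * fourier n t := fun m =>
    Continuous.integrable_of_hasCompactSupport (by fun_prop) (HasCompactSupport.of_compactSpace _)
  have hsρ : Summable fun m : ℤ => ρ ^ m.natAbs := by
    have hs := summable_geometric_of_lt_one h0 h1
    exact Summable.of_nat_of_neg (by simpa using hs) (by simpa using hs)
  have hsum : Summable fun m : ℤ => ∫ t : AddCircle (2 * Real.pi),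
      ‖((ρ ^ m.natAbs : ℝ) : ℂ) * fourier m t * fourier n t‖ := by
    have : ∀ (m : ℤ) (t : AddCircle (2 * Real.pi)),
        ‖((ρ ^ m.natAbs : ℝ) : ℂ) * fourier m t * fourier n t‖ = ρ ^ m.natAbs := by
      intro m t
      rw [norm_mul, norm_mul, Complex.norm_real, Real.norm_of_nonneg (by positivity)]
      simp [fourier_apply, Circle.norm_coe]
    simp only [this, integral_const, smul_eq_mul]
    exact hsρ.mul_left _
  have h := hasSum_integral_of_summable_integral_norm hint hsum
  have hterm : ∀ m : ℤ, ∫ t : AddCircle (2 * Real.pi),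
      ((ρ ^ m.natAbs : ℝ) : ℂ) * fourier m t * fourier n t =
      if m = -n then ((ρ ^ m.natAbs : ℝ) : ℂ) * ((2 * Real.pi : ℝ) : ℂ) else 0 := by
    intro m
    simp_rw [mul_assoc, ← fourier_add]
    rw [integral_const_mul, integral_fourier]
    simp only [← eq_neg_iff_add_eq_zero, mul_ite, mul_zero]
  simp_rw [hterm] at h
  have h' := h.unique (hasSum_single (-n) fun m hm => if_neg hm)
  rw [if_pos rfl, Int.natAbs_neg] at h'
  rw [← h']
  refine integral_congr_ae (Eventually.of_forall fun t => ?_)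
  beta_reduce
  rw [tsum_mul_right, (hasSum_poissonKernel_one h0 h1 t).tsum_eq]

theorem continuous_poissonKernel {ρ : ℝ} (h0 : 0 ≤ ρ) (h1 : ρ < 1) :
    Continuous (poissonKernel ρ : Torus d → ℝ) := by
  have hcos : Continuous fun t : AddCircle (2 * Real.pi) => Real.Angle.cos t :=
    Real.Angle.continuous_cos
  refine continuous_finsetProd _ fun j _ => continuous_const.div ?_ fun t => ?_
  · have := hcos.comp (continuous_apply (A := fun _ : Fin d => AddCircle (2 * Real.pi)) j)
    exact (continuous_const.sub (continuous_const.mul this)).add continuous_const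
  · have h2 : Real.Angle.cos (t j) ≤ 1 := by
      nlinarith [Real.Angle.cos_sq_add_sin_sq (t j), sq_nonneg (Real.Angle.sin (t j))]
    have : 0 < (1 - ρ) ^ 2 := by have : 0 < 1 - ρ := by linarith
                                 positivity
    nlinarith

theorem integral_poissonKernel_mul_expo {ρ : ℝ} (h0 : 0 ≤ ρ) (h1 : ρ < 1) (k : Fin d → ℤ) :
    ∫ t : Torus d, (poissonKernel ρ t : ℂ) * expo k t =
      ((ρ ^ l1 k : ℝ) : ℂ) * ((2 * Real.pi : ℝ) : ℂ) ^ d := by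
  simp only [poissonKernel, expo, Complex.ofReal_prod, ← Finset.prod_mul_distrib]
  rw [integral_fintype_prod_volume_eq_prod fun j (t : AddCircle (2 * Real.pi)) =>
    (((1 - ρ ^ 2) / (1 - 2 * ρ * Real.Angle.cos t + ρ ^ 2) : ℝ) : ℂ) * fourier (k j) t]
  simp_rw [integral_poissonKernel_one h0 h1]
  rw [Finset.prod_mul_distrib, Finset.prod_const, Finset.card_univ, Fintype.card_fin, l1,
    ← Finset.prod_pow_eq_pow_sum, Complex.ofReal_prod]

theorem fourierSeries_poissonIntegral {g : Torus d → ℂ} (hg : Integrable g) {ρ : ℝ}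
    (h0 : 0 ≤ ρ) (h1 : ρ < 1) :
    fourierSeries (poissonIntegral g ρ) = fun k => ((ρ ^ l1 k : ℝ) : ℂ) * fourierSeries g k := by
  have _ : (volume : Measure (Torus d)).IsNegInvariant :=
    Measure.IsAddHaarMeasure.isNegInvariant_of_regular _
  funext k
  -- Reflecting `t` turns the Poisson integral into a convolution, and splitting `e^{-i(k,x)}`
  -- between `x - t` and `t` keeps it one. The integral of a convolution is the product of the
  -- integrals.
  set G : Torus d → ℂ := fun x => g x * expo (-k) x with hG
  set H : Torus d → ℂ := fun t => (poissonKernel ρ (-t) : ℂ) * expo k (-t) with hH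
  have hGi : Integrable G := integrable_mul_expo hg _
  have hHi : Integrable H := integrable_of_continuous
    ((Complex.continuous_ofReal.comp ((continuous_poissonKernel h0 h1).comp continuous_neg)).mul
      ((continuous_expo k).comp continuous_neg))
  have hpt : ∀ x, (∫ t, g (x + t) * (poissonKernel ρ t : ℂ)) * expo (-k) x =
      convolution H G (ContinuousLinearMap.mul ℂ ℂ) volume x := by
    intro x
    rw [convolution, ← integral_mul_const, ← integral_neg_eq_self]
    refine integral_congr_ae (Eventually.of_forall fun t => ?_)
    simp only [hG, hH, ContinuousLinearMap.mul_apply']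
    have h2 : expo k (-t) * expo (-k) (x - t) = expo (-k) x := by
      rw [sub_eq_add_neg, expo_add_right, mul_left_comm, ← expo_add, add_neg_cancel]
      simp [expo]
    rw [← sub_eq_add_neg]
    linear_combination (-(g (x - t) * (poissonKernel ρ (-t) : ℂ))) * h2
  have hH' : ∫ t, H t = ((ρ ^ l1 k : ℝ) : ℂ) * ((2 * Real.pi : ℝ) : ℂ) ^ d := by
    rw [← integral_poissonKernel_mul_expo h0 h1, ← integral_neg_eq_self]
    simp only [hH, neg_neg]
  simp only [fourierSeries, poissonIntegral, mul_assoc]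
  rw [integral_const_mul]
  simp_rw [hpt]
  rw [integral_convolution _ hHi hGi, ContinuousLinearMap.mul_apply', hH', inv_pow]
  have := two_pi_pow_ne_zero (d := d)
  field_simp
  rfl

theorem poissonRate_iff_poissonIntegral {p : ℝ} {r : ℕ} {ω : ℝ → ℝ} {f g : Torus d → ℂ}
    (hg : Integrable g) (hgf : fourierSeries g = radialDeriv r f) :
    PoissonRate p r ω f ↔
      SpBigO p (fun ρ => poissonIntegral g ρ) fun ρ => ω (1 - ρ) / (1 - ρ) := by
  refine exists_congr fun C => eventually_congr ?_
  filter_upwards [eventually_zero_lt_lt_one] with ρ hρ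
  have : fourierSeries (poissonSeries (radialDeriv r f) ρ) =
      fourierSeries (poissonIntegral g ρ) := by
    rw [fourierSeries_poissonIntegral hg hρ.1.le hρ.2, hgf,
      fourierSeries_poissonSeries_radialDeriv f r hρ.1 hρ.2, radialDeriv_eq]
    funext k
    simp only [derivSeries]
    push_cast; ring
  rw [this]

theorem inSpH_iff {p : ℝ} {ω : ℝ → ℝ} {g : Torus d → ℂ} (hg : Integrable g) :
    InSpH p ω g ↔ SeriesInSpH p ω (fourierSeries g) := by
  unfold InSpH SeriesInSpH modulus modulusSeries
  simp_rw [fourierSeries_translate hg]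

end poisson

/-! ### Riesz–Fischer: when the derivative is a function -/

section rieszFischer
variable {d : ℕ}

/-- Almost all coefficients have modulus at most `1`, and for these `|a|² ≤ |a|^p`. -/
theorem summable_sq_of_spNorm_lt_top {p : ℝ} (hp : 1 ≤ p) (hp2 : p ≤ 2) {a : TrigSeries d}
    (h : spNorm p a < ⊤) : Summable fun k => ‖a k‖ ^ 2 := by
  have h1 : ∑' k, ENNReal.ofReal (‖a k‖ ^ p) ≠ ⊤ := by
    intro htop
    rw [spNorm, htop, ENNReal.top_rpow_of_pos (by positivity)] at h
    exact lt_irrefl _ h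
  have hs : Summable fun k => ‖a k‖ ^ p := by
    have := ENNReal.summable_toReal h1
    refine this.congr fun k => ENNReal.toReal_ofReal (by positivity)
  have hev : ∀ᶠ k in cofinite, ‖a k‖ ^ p < 1 :=
    hs.tendsto_cofinite_zero.eventually_lt_const one_pos
  refine hs.of_norm_bounded_eventually (hev.mono fun k hk => ?_)
  have h2 : ‖a k‖ ≤ 1 := by
    by_contra! hlt
    exact absurd hk (not_lt.2 (Real.one_le_rpow hlt.le (by linarith)))
  rw [Real.norm_of_nonneg (by positivity), ← Real.rpow_natCast]
  rcases (norm_nonneg (a k)).eq_or_lt with h0 | h0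
  · rw [← h0, Real.zero_rpow (by norm_num), Real.zero_rpow (by linarith)]
  · exact Real.rpow_le_rpow_of_exponent_ge h0 h2 (by exact_mod_cast hp2)

theorem exists_integrable_fourierSeries_eq {a : TrigSeries d}
    (ha : Summable fun k => ‖a k‖ ^ 2) :
    ∃ g : Torus d → ℂ, Integrable g ∧ fourierSeries g = a := by
  -- The torus has measure `(2π)^d`, so this factor makes the exponentials orthonormal. A Fourier
  -- coefficient carries `s²` and an inner product only `s`, hence the `s⁻¹` in the function chosen
  -- at the end.
  set s : ℝ := Real.sqrt ((2 * Real.pi) ^ d)⁻¹ with hs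
  have hs2 : s * s = ((2 * Real.pi) ^ d)⁻¹ := Real.mul_self_sqrt (by positivity)
  have hs0 : 0 < s := Real.sqrt_pos.2 (by positivity)
  have hmem : ∀ k : Fin d → ℤ, MemLp (fun x : Torus d => (s : ℂ) * expo k x) 2 volume := fun k =>
    MemLp.of_bound (continuous_const.mul (continuous_expo k)).aestronglyMeasurable s
      (Eventually.of_forall fun x => by
        rw [norm_mul, norm_expo, mul_one, Complex.norm_real, Real.norm_of_nonneg hs0.le])
  set v : (Fin d → ℤ) → Lp ℂ 2 (volume : Measure (Torus d)) := fun k => (hmem k).toLp with hv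
  have hinner : ∀ (k : Fin d → ℤ) (F : Lp ℂ 2 (volume : Measure (Torus d))),
      inner ℂ (v k) F = (s : ℂ) * ∫ x, F x * expo (-k) x := by
    intro k F
    rw [L2.inner_def, ← integral_const_mul]
    refine integral_congr_ae ?_
    filter_upwards [(hmem k).coeFn_toLp] with x hx
    rw [hv, hx, RCLike.inner_apply, map_mul, Complex.conj_ofReal, expo_neg_eq_conj]
    ring
  have hsc : (s : ℂ) * s = (((2 * Real.pi : ℝ) : ℂ) ^ d)⁻¹ := by
    exact_mod_cast congrArg Complex.ofReal hs2
  have hon : Orthonormal ℂ v := by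
    rw [orthonormal_iff_ite]
    intro k l
    rw [hinner]
    have : ∫ x, (v l : Torus d → ℂ) x * expo (-k) x = s * ∫ x, expo (l + -k) x := by
      rw [← integral_const_mul]
      refine integral_congr_ae ?_
      filter_upwards [(hmem l).coeFn_toLp] with x hx
      rw [hv, hx, expo_add, mul_assoc]
    rw [this, integral_expo, ← mul_assoc, hsc, ← sub_eq_add_neg]
    by_cases hkl : k = l
    · simp only [hkl, sub_self, if_true]
      exact inv_mul_cancel₀ two_pi_pow_ne_zero
    · rw [if_neg hkl, if_neg (sub_ne_zero.2 (Ne.symm hkl)), mul_zero]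
  have hsum : Summable fun k => a k • v k := by
    have := (hon.orthogonalFamily.summable_iff_norm_sq_summable a).2 ha
    simpa using this
  set F := ∑' k, a k • v k with hF
  have hcoef : ∀ l, inner ℂ (v l) F = a l := by
    intro l
    have h := (innerSL ℂ (v l)).hasSum hsum.hasSum
    have h2 : ∀ k, innerSL ℂ (v l) (a k • v k) = if k = l then a k else 0 := by
      intro k
      rw [innerSL_apply_apply, inner_smul_right, orthonormal_iff_ite.1 hon]
      simp [eq_comm]
    simp_rw [h2] at h
    have := h.unique (hasSum_single l fun k hk => if_neg hk)
    rwa [if_pos rfl, innerSL_apply_apply] at this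
  refine ⟨fun x => ((s : ℂ))⁻¹ * F x, ((Lp.memLp F).integrable (by norm_num)).const_mul _, ?_⟩
  funext l
  rw [← hcoef l, hinner, fourierSeries]
  simp only [mul_assoc]
  rw [integral_const_mul, inv_pow, ← hsc]
  have : (s : ℂ) ≠ 0 := by exact_mod_cast hs0.ne'
  field_simp

end rieszFischer

end SpApprox

end

/-! ### Assembly of the theorem -/

open SpApprox in
theorem theorem3p4 (d r : ℕ) (hd : 1 ≤ d) (hr : 1 ≤ r) (p : ℝ) (hp : 1 ≤ p)
    (ω : ℝ → ℝ) (hω : IsMajorant ω) (hB : BariCondition ω)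
    (f : Torus d → ℂ) (hf : MeasureTheory.Integrable f) :
    -- i) and ii) are equivalent
    (ApproxRate p r ω f ↔ PoissonRate p r ω f) ∧
    -- i) or ii) implies iii); when `r ≥ 2` and `f` is a polynomial of degree at most `r - 1`,
    -- this needs `δ = O(ω(δ))`
    ((2 ≤ r → (∀ k, r ≤ l1 k → fourierSeries f k = 0) →
        (fun δ : ℝ => δ) =O[𝓝[>] (0 : ℝ)] ω) →
      (ApproxRate p r ω f ∨ PoissonRate p r ω f) →
        SeriesInSpH p ω (radialDeriv (r - 1) f)) ∧
    -- if the spectrum of `f` lies in `ℤ_+^d ∪ ℤ_-^d`, then iii) implies i) and ii)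
    (SpectrumInY f → SeriesInSpH p ω (radialDeriv (r - 1) f) →
      ApproxRate p r ω f ∧ PoissonRate p r ω f) ∧
    -- if `f^{[r]}` is a function, then ii) is the condition on its Poisson integral
    (∀ g : Torus d → ℂ, MeasureTheory.Integrable g → fourierSeries g = radialDeriv r f →
      (PoissonRate p r ω f ↔
        SpBigO p (fun ρ => poissonIntegral g ρ) fun ρ => ω (1 - ρ) / (1 - ρ))) ∧
    -- if `f^{[r-1]}` is a function, then iii) is the condition on this function
    (∀ g : Torus d → ℂ, MeasureTheory.Integrable g → fourierSeries g = radialDeriv (r - 1) f →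
      (SeriesInSpH p ω (radialDeriv (r - 1) f) ↔ InSpH p ω g)) ∧
    -- under i) or ii), `f^{[r-1]}` is a function whenever `p ≤ 2` or `r = 1`
    (p ≤ 2 ∨ r = 1 → (ApproxRate p r ω f ∨ PoissonRate p r ω f) →
      ∃ g : Torus d → ℂ, MeasureTheory.Integrable g ∧ fourierSeries g = radialDeriv (r - 1) f) := by
  have hPA : PoissonRate p r ω f ↔ ApproxRate p r ω f := by
    rw [approxRate_iff hf, poissonRate_iff]
    exact ⟨fun h => h.approxRate hr hp hω hB, fun h => h.poissonRate hr hp⟩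
  have hor : ApproxRate p r ω f ∨ PoissonRate p r ω f →
      CoeffPoissonRate p r ω (fourierSeries f) := fun h =>
    poissonRate_iff.1 (h.elim hPA.2 id)
  refine ⟨hPA.symm, fun hO h => ?_, fun hY h => ?_, fun g hg hgf =>
    poissonRate_iff_poissonIntegral hg hgf, fun g hg hgf => ?_, fun hcase h => ?_⟩
  · rw [radialDeriv_eq]
    exact (hor h).seriesInSpH hr hp hω hB hO
  · rw [radialDeriv_eq] at h
    have h2 := poissonRate_iff.2 (coeffPoissonRate_of_seriesInSpH hr hp hω hB hY h)
    exact ⟨hPA.1 h2, h2⟩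
  · rw [inSpH_iff hg, hgf]
  · rw [radialDeriv_eq]
    rcases hcase with hp2 | rfl
    · exact exists_integrable_fourierSeries_eq
        (summable_sq_of_spNorm_lt_top hp hp2 ((hor h).spNorm_lt_top hr hp hω hB))
    · exact ⟨f, hf, by funext k; simp [derivSeries]⟩
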